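/- Let $\mathcal A$ be an additive category and $N\in\mathbb N=\{0,1,2,\dots\}$. An $N$-complex in $\mathcal A$ is a diagram $\cdots\to X^{i}\xrightarrow{d}X^{i+1}\to\cdots$ $(i\in\mathbb Z)$ in $\mathcal A$ with $d^N=0$; with degreewise morphisms commuting with $d$ these form the category $\mathrm C_N(\mathcal A)$. Let $\mathcal S_\oplus$ be the class of sequences $0\to X\xrightarrow{f}Y\xrightarrow{g}Z\to 0$ in $\mathrm C_N(\mathcal A)$ which in every degree are isomorphic to a split sequence $0\to A\to A\oplus B\to B\to 0$ in $\mathcal A$. An object $I$ is $\mathcal S_\oplus$-injective if every morphism $X\to I$ extends along $f$, and $P$ is $\mathcal S_\oplus$-projective if every morphism $P\to Z$ lifts along $g$, for all sequences in $\mathcal S_\oplus$. Let $\mathrm K_N(\mathcal A)$ be the stable category of $(\mathrm C_N(\mathcal A),\mathcal S_\oplus)$: it has the same objects, and its morphisms are those of $\mathrm C_N(\mathcal A)$ modulo the ideal of morphisms factoring through an object that is both $\mathcal S_\oplus$-injective and $\mathcal S_\oplus$-projective. Then $\mathrm K_N(\mathcal A)$ is a triangulated category (octahedral axiom included), with a suspension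 $\Sigma$ and a class of distinguished triangles as follows. (1) For every sequence $0\to X\xrightarrow{\iota} I\xrightarrow{\pi} Q\to 0$ in $\mathcal S_\oplus$ with $I$ both $\mathcal S_\oplus$-injective and $\mathcal S_\oplus$-projective there is an isomorphism $e: Q\cong\Sigma X$ in $\mathrm K_N(\mathcal A)$, and these are natural: if morphisms $\varphi:X\to X'$, $a:I\to I'$, $b:Q\to Q'$ in $\mathrm C_N(\mathcal A)$ form a morphism between two such sequences, then $e'\circ b=\Sigma(\varphi)\circ e$ in $\mathrm K_N(\mathcal A)$. (2) For every sequence $0\to X\xrightarrow{f}Y\xrightarrow{g}Z\to0$ in $\mathcal S_\oplus$ there are a sequence $0\to X\xrightarrow{\iota} I\xrightarrow{\pi} Q\to 0$ as in (1) and morphisms $j:Y\to I$, $k:Z\to Q$ in $\mathrm C_N(\mathcal A)$ with $j f=\iota$ and $k g=\pi j$. The composite $h: Z\xrightarrow{k}Q\xrightarrow{e}\Sigma X$ in $\mathrm K_N(\mathcal A)$ does not depend on these choices, and $X\xrightarrow{f}Y\xrightarrow{g}Z\xrightarrow{h}\Sigma X$ is a distinguished triangle. (3) Every distinguished triangle in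 $\mathrm K_N(\mathcal A)$ is isomorphic to a triangle as in (2). -/

import Mathlib

open CategoryTheory CategoryTheory.Limits CategoryTheory.Pretriangulated

universe v u

noncomputable section

/-! ### Objects projective and injective relative to a class of short exact sequences, and the
stable category -/

namespace RelativeExact

variable {C : Type u} [Category.{v} C] [Preadditive C] (S : ObjectProperty (ShortComplex C))

/-- `I` is `S`-injective: every morphism into `I` extends along `E.f : E.X₁ ⟶ E.X₂` for every
short exact sequence `E.X₁ ⟶ E.X₂ ⟶ E.X₃` of the class `S`. -/
def IsInjective (I : C) : Prop :=
  ∀ E : ShortComplex C, S E → ∀ f : E.X₁ ⟶ I, ∃ g : E.X₂ ⟶ I, E.f ≫ g = f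

/-- `P` is `S`-projective: every morphism out of `P` lifts along `E.g : E.X₂ ⟶ E.X₃` for every
short exact sequence `E.X₁ ⟶ E.X₂ ⟶ E.X₃` of the class `S`. -/
def IsProjective (P : C) : Prop :=
  ∀ E : ShortComplex C, S E → ∀ f : P ⟶ E.X₃, ∃ g : P ⟶ E.X₂, g ≫ E.g = f

/-- An object which is both `S`-injective and `S`-projective. -/
def IsProjInj (P : C) : Prop :=
  IsInjective S P ∧ IsProjective S P

/-- A morphism which factors through an `S`-injective-projective object. -/
def FactorsThroughProjInj {X Y : C} (f : X ⟶ Y) : Prop :=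
  ∃ (P : C) (a : X ⟶ P) (b : P ⟶ Y), IsProjInj S P ∧ a ≫ b = f

/-- Two parallel morphisms are identified when their difference factors through an
`S`-injective-projective object. -/
def stableRel : HomRel C :=
  fun _ _ f g => FactorsThroughProjInj S (f - g)

variable {S}

lemma IsProjInj.biprod [HasBinaryBiproducts C] {P Q : C} (hP : IsProjInj S P)
    (hQ : IsProjInj S Q) : IsProjInj S (P ⊞ Q) := by
  refine ⟨fun E hE f => ?_, fun E hE f => ?_⟩
  · obtain ⟨a, ha⟩ := hP.1 E hE (f ≫ biprod.fst)
    obtain ⟨b, hb⟩ := hQ.1 E hE (f ≫ biprod.snd)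
    refine ⟨biprod.lift a b, ?_⟩
    ext <;> simp [ha, hb]
  · obtain ⟨a, ha⟩ := hP.2 E hE (biprod.inl ≫ f)
    obtain ⟨b, hb⟩ := hQ.2 E hE (biprod.inr ≫ f)
    refine ⟨biprod.desc a b, ?_⟩
    ext <;> simp [ha, hb]

lemma IsProjInj.of_isZero {Z : C} (hZ : IsZero Z) : IsProjInj S Z :=
  ⟨fun _ _ _ => ⟨0, hZ.eq_of_tgt _ _⟩, fun _ _ _ => ⟨0, hZ.eq_of_src _ _⟩⟩

lemma FactorsThroughProjInj.zero [HasZeroObject C] {X Y : C} :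
    FactorsThroughProjInj S (0 : X ⟶ Y) := by
  obtain ⟨Z, hZ⟩ := HasZeroObject.zero (C := C)
  exact ⟨Z, 0, 0, IsProjInj.of_isZero hZ, by simp⟩

lemma FactorsThroughProjInj.neg {X Y : C} {f : X ⟶ Y} (hf : FactorsThroughProjInj S f) :
    FactorsThroughProjInj S (-f) := by
  obtain ⟨P, a, b, hP, h⟩ := hf
  exact ⟨P, -a, b, hP, by simp [h]⟩

lemma FactorsThroughProjInj.add [HasFiniteBiproducts C] {X Y : C} {f g : X ⟶ Y}
    (hf : FactorsThroughProjInj S f) (hg : FactorsThroughProjInj S g) :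
    FactorsThroughProjInj S (f + g) := by
  have := hasBinaryBiproducts_of_finite_biproducts C
  obtain ⟨P, a, b, hP, rfl⟩ := hf
  obtain ⟨Q, c, d, hQ, rfl⟩ := hg
  exact ⟨P ⊞ Q, biprod.lift a c, biprod.desc b d, hP.biprod hQ, by simp⟩

lemma FactorsThroughProjInj.precomp {W X Y : C} {f : X ⟶ Y} (e : W ⟶ X)
    (hf : FactorsThroughProjInj S f) : FactorsThroughProjInj S (e ≫ f) := by
  obtain ⟨P, a, b, hP, rfl⟩ := hf
  exact ⟨P, e ≫ a, b, hP, by simp⟩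

lemma FactorsThroughProjInj.postcomp {X Y Z : C} {f : X ⟶ Y} (e : Y ⟶ Z)
    (hf : FactorsThroughProjInj S f) : FactorsThroughProjInj S (f ≫ e) := by
  obtain ⟨P, a, b, hP, rfl⟩ := hf
  exact ⟨P, a, b ≫ e, hP, by simp⟩

variable (S)

instance stableRel_congruence [HasFiniteBiproducts C] : Congruence (stableRel S) where
  equivalence :=
    { refl := fun f => by
        simpa [stableRel] using FactorsThroughProjInj.zero
      symm := fun {f g} h => by
        simpa [stableRel] using FactorsThroughProjInj.neg h
      trans := fun {f g k} h h' => by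
        simpa [stableRel] using FactorsThroughProjInj.add h h' }
  comp_left e f g h := by
    simpa [stableRel] using FactorsThroughProjInj.precomp e h
  comp_right e h := by
    simpa [stableRel] using FactorsThroughProjInj.postcomp e h

lemma stableRel_add [HasFiniteBiproducts C] ⦃X Y : C⦄ (f₁ f₂ g₁ g₂ : X ⟶ Y)
    (hf : stableRel S f₁ f₂) (hg : stableRel S g₁ g₂) :
    stableRel S (f₁ + g₁) (f₂ + g₂) := by
  have := FactorsThroughProjInj.add hf hg
  rwa [← add_sub_add_comm] at this

/-- The stable category of `(C, S)`: it has the objects of `C`, and its morphisms `X ⟶ Y` are the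
morphisms of `C` modulo the two-sided ideal of those that factor through an
`S`-injective-projective object. -/
def StableCategory : Type u := CategoryTheory.Quotient (stableRel S)

instance : Category.{v} (StableCategory S) :=
  inferInstanceAs (Category (CategoryTheory.Quotient (stableRel S)))

/-- The quotient functor from `C` to the stable category. -/
def toStable : C ⥤ StableCategory S := CategoryTheory.Quotient.functor (stableRel S)

variable [HasFiniteBiproducts C]

instance : Preadditive (StableCategory S) :=
  CategoryTheory.Quotient.preadditive (stableRel S) (stableRel_add S)

instance : (toStable S).Additive :=
  CategoryTheory.Quotient.functor_additive (stableRel S) (stableRel_add S)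

instance : HasZeroObject (StableCategory S) := by
  obtain ⟨Z, hZ⟩ := HasZeroObject.zero (C := C)
  exact ⟨_, (toStable S).map_isZero hZ⟩

end RelativeExact

namespace RelativeExact

variable {C : Type u} [Category.{v} C] [Preadditive C] (S : ObjectProperty (ShortComplex C))

/-- An `S`-exact sequence `X ⟶ I ⟶ Q` whose middle term is `S`-injective-projective; its last
term `Q` is a model of the suspension of `X` in the stable category. -/
structure Hull (X : C) where
  /-- the middle term -/
  I : C
  /-- the last term -/
  Q : C
  /-- the first morphism -/
  ι : X ⟶ I
  /-- the second morphism -/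
  π : I ⟶ Q
  zero : ι ≫ π = 0
  exact : S (ShortComplex.mk ι π zero)
  projInj : IsProjInj S I

variable {S} [HasFiniteBiproducts C] [HasShift (StableCategory S) ℤ]

/-- Let `e` identify `Q` with `X⟦1⟧` in the stable category, for all sequences `X ⟶ I ⟶ Q` as in
`Hull`. The family `e` is natural if for every commutative diagram with rows `X ⟶ I ⟶ Q` and
`X' ⟶ I' ⟶ Q'` of this kind and vertical morphisms `f`, `a`, `b` in `C`, the class of `b`
corresponds to the shift of the class of `f`. -/
def IsNaturalSuspension
    (e : ∀ (X : C) (H : Hull S X), (toStable S).obj H.Q ≅ ((toStable S).obj X)⟦(1 : ℤ)⟧) :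
    Prop :=
  ∀ ⦃X X' : C⦄ (H : Hull S X) (H' : Hull S X') (f : X ⟶ X') (a : H.I ⟶ H'.I) (b : H.Q ⟶ H'.Q),
    H.ι ≫ a = f ≫ H'.ι → H.π ≫ b = a ≫ H'.π →
      (toStable S).map b ≫ (e X' H').hom = (e X H).hom ≫ ((toStable S).map f)⟦(1 : ℤ)⟧'

/-- `h : E.X₃ ⟶ E.X₁⟦1⟧` is induced by the sequence `E`: there is a commutative diagram in `C`
with first row `E.X₁ ⟶ E.X₂ ⟶ E.X₃`, second row a sequence `E.X₁ ⟶ I ⟶ Q` as in `Hull`, and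
vertical morphisms `𝟙`, `j`, `k`, such that `h` is the class of `k` followed by the
identification of `Q` with `E.X₁⟦1⟧`. -/
def IsInducedBy
    (e : ∀ (X : C) (H : Hull S X), (toStable S).obj H.Q ≅ ((toStable S).obj X)⟦(1 : ℤ)⟧)
    (E : ShortComplex C)
    (h : (toStable S).obj E.X₃ ⟶ ((toStable S).obj E.X₁)⟦(1 : ℤ)⟧) : Prop :=
  ∃ (H : Hull S E.X₁) (j : E.X₂ ⟶ H.I) (k : E.X₃ ⟶ H.Q),
    E.f ≫ j = H.ι ∧ E.g ≫ k = j ≫ H.π ∧ h = (toStable S).map k ≫ (e E.X₁ H).hom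

end RelativeExact

/-! ### `N`-complexes -/

section NComplexes

variable (A : Type u) [Category.{v} A]

/-- The category of `∞`-complexes `⋯ ⟶ X i ⟶ X (i + 1) ⟶ ⋯` in `A`: functors to `A` from the
ordered set of integers. -/
abbrev InfComplex : Type (max u v) := ℤ ⥤ A

variable [Preadditive A] (N : ℕ)

/-- An `∞`-complex `X` is an `N`-complex if the `N`-fold composite `d ^ N : X i ⟶ X (i + N)` of
the differential is zero for every `i`. -/
def isNComplex : ObjectProperty (InfComplex A) :=
  fun X => ∀ i : ℤ, X.map (homOfLE (by lia : i ≤ i + (N : ℤ))) = 0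

/-- The category of `N`-complexes in `A`, a full subcategory of the `∞`-complexes. -/
abbrev NComplex : Type (max u v) := (isNComplex A N).FullSubcategory

/-- The functor taking an `N`-complex to its object in degree `i`. -/
abbrev NComplex.level (i : ℤ) : NComplex A N ⥤ A :=
  (isNComplex A N).ι ⋙ (evaluation ℤ A).obj i

/-- The class of levelwise split short exact sequences of `N`-complexes: in every degree the
sequence is isomorphic to `X ⟶ X ⊞ Y ⟶ Y`, that is, it admits a splitting in `A`. -/
def levelwiseSplit : ObjectProperty (ShortComplex (NComplex A N)) :=
  fun E => ∀ i : ℤ, Nonempty (E.map (NComplex.level A N i)).Splitting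

instance [HasFiniteBiproducts A] : (isNComplex A N).IsClosedUnderFiniteProducts where
  isClosedUnderLimitsOfShape J _ :=
    { limitsOfShape_le := by
        rintro X ⟨p⟩ i
        refine (isLimitOfPreserves ((evaluation ℤ A).obj (i + (N : ℤ))) p.isLimit).hom_ext ?_
        intro j
        have h := p.prop_diag_obj j i
        have := (p.π.app j).naturality (homOfLE (by lia : i ≤ i + (N : ℤ)))
        simp at this
        simp [h] }

instance [HasFiniteBiproducts A] : HasFiniteBiproducts (NComplex A N) :=
  HasFiniteBiproducts.of_hasFiniteProducts

/-- The homotopy category of `N`-complexes: the stable category of the category of `N`-complexes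
with respect to the levelwise split short exact sequences. -/
abbrev KN : Type (max u v) := RelativeExact.StableCategory (levelwiseSplit A N)

/-- The quotient functor from `N`-complexes to their homotopy category. -/
abbrev toKN : NComplex A N ⥤ KN A N := RelativeExact.toStable (levelwiseSplit A N)

end NComplexes

end

noncomputable section

open RelativeExact

namespace RelativeExact

variable {C : Type u} [Category.{v} C] [Preadditive C] [HasFiniteBiproducts C]

attribute [local instance] CategoryStruct.toQuiver hasBinaryBiproducts_of_finite_biproducts

/-! ### Classes of short exact sequences with enough injective-projective objects -/

/-! The degreewise split sequences make the `N`-complexes a Frobenius category, and by Happel's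
argument the stable category of a Frobenius category is triangulated.

For `0 < N`, let a strip be one object of `A` repeated in `N` consecutive degrees with identity
differentials. Morphisms into it correspond to morphisms in `A` at its top degree, morphisms out of
it to morphisms at its bottom degree. Degreewise retractions and sections therefore make strips, and
their locally finite sums, injective and projective (`isProjInj_strip`). Every `X` embeds degreewise
split into the sum over `l` of the strips on `X l` ending in degree `l`, and is dually a quotient of
those starting in degree `l` (`nonempty_hull`, `exists_cohull`). For `N = 0` every complex is zero.

`IsFrobenius` isolates what Happel's argument uses. The suspension of `X` is the last term of a
hull; it is an equivalence because every object is also the last term of a hull. Every morphism is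
stably isomorphic to an inflation (`exists_inflation`), which gives cones. Squares that commute
stably can be made to commute strictly (`exists_hom`), which gives morphisms of triangles. Rotation
comes from the sequence `Y ⟶ Z ⊞ I ⟶ Q`, and the octahedron from the third isomorphism theorem for a
composite of inflations.

A `ℤ`-shift needs coherent powers of the suspension, which is only an equivalence. It is replaced by
translation on the equivalent category of towers, sequences with `X (n + 1) ≅ F (X n)`, and the
shift is transported back. -/

/-- A class `S` of short sequences in an additive category is Frobenius if its members are
kernel-cokernel pairs, it is stable under the constructions below, and it has enough
injective-projective objects on both sides. -/
structure IsFrobenius (S : ObjectProperty (ShortComplex C)) : Prop where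
  epi {E : ShortComplex C} (hE : S E) : Epi E.g
  mono {E : ShortComplex C} (hE : S E) : Mono E.f
  exists_desc {E : ShortComplex C} (hE : S E) {W : C} (a : E.X₂ ⟶ W) (w : E.f ≫ a = 0) :
    ∃ b : E.X₃ ⟶ W, E.g ≫ b = a
  exists_lift {E : ShortComplex C} (hE : S E) {W : C} (a : W ⟶ E.X₂) (w : a ≫ E.g = 0) :
    ∃ b : W ⟶ E.X₁, b ≫ E.f = a
  of_isZero (X : C) {Z : C} (hZ : IsZero Z) : S (ShortComplex.mk (𝟙 X) (0 : X ⟶ Z) (by simp))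
  -- Applied to a hull of the source, this replaces any morphism by an inflation.
  exists_biprod_lift {E : ShortComplex C} (hE : S E) {W : C} (a : E.X₁ ⟶ W) :
    ∃ (Q : C) (q : W ⊞ E.X₂ ⟶ Q) (w : biprod.lift a E.f ≫ q = 0), S (ShortComplex.mk _ q w)
  -- The square of `g`, `j`, `k`, `g'` is bicartesian, both rows starting at `X`; this yields
  -- rotated triangles.
  biprod_lift_desc {X Y Z Y' Z' : C} {f : X ⟶ Y} {g : Y ⟶ Z} {f' : X ⟶ Y'} {g' : Y' ⟶ Z'}
    {w : f ≫ g = 0} {w' : f' ≫ g' = 0} (hE : S (ShortComplex.mk f g w))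
    (hE' : S (ShortComplex.mk f' g' w')) (j : Y ⟶ Y') (k : Z ⟶ Z') (hj : f ≫ j = f')
    (hk : g ≫ k = j ≫ g') :
    S (ShortComplex.mk (biprod.lift g j) (biprod.desc k (-g')) (by simp [hk]))
  -- Third isomorphism theorem `(Z/X)/(Y/X) = Z/Y`, the source of the octahedron.
  exists_comp {X Y Z Z' X' : C} {f : X ⟶ Y} {v : Y ⟶ Z'} {g : Y ⟶ Z} {u : Z ⟶ X'}
    {w : f ≫ v = 0} {w' : g ≫ u = 0} (hf : S (ShortComplex.mk f v w))
    (hg : S (ShortComplex.mk g u w')) :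
    ∃ (Y' : C) (q : Z ⟶ Y') (m : Z' ⟶ Y') (m' : Y' ⟶ X') (w₁ : (f ≫ g) ≫ q = 0)
      (w₂ : m ≫ m' = 0), S (ShortComplex.mk (f ≫ g) q w₁) ∧ S (ShortComplex.mk m m' w₂) ∧
        v ≫ m = g ≫ q ∧ q ≫ m' = u
  nonempty_hull (X : C) : Nonempty (Hull S X)
  exists_cohull (X : C) : ∃ (W P : C) (i : W ⟶ P) (p : P ⟶ X) (w : i ≫ p = 0),
    S (ShortComplex.mk i p w) ∧ IsProjInj S P

variable {S : ObjectProperty (ShortComplex C)}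

instance : (toStable S).Full := CategoryTheory.Quotient.full_functor (stableRel S)

instance : (toStable S).EssSurj := CategoryTheory.Quotient.essSurj_functor (stableRel S)

lemma toStable_map_eq_iff {X Y : C} (f g : X ⟶ Y) :
    (toStable S).map f = (toStable S).map g ↔ FactorsThroughProjInj S (f - g) :=
  CategoryTheory.Quotient.functor_map_eq_iff (stableRel S) f g

lemma toStable_map_eq_zero_iff {X Y : C} (f : X ⟶ Y) :
    (toStable S).map f = 0 ↔ FactorsThroughProjInj S f := by
  rw [← (toStable S).map_zero, toStable_map_eq_iff, sub_zero]

lemma toStable_map_eq {X Y P : C} (hP : IsProjInj S P) {f g : X ⟶ Y} (a : X ⟶ P) (b : P ⟶ Y)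
    (h : f = g + a ≫ b) : (toStable S).map f = (toStable S).map g := by
  rw [toStable_map_eq_iff]
  exact ⟨P, a, b, hP, by rw [h, add_sub_cancel_left]⟩

lemma IsProjInj.exists_desc {P : C} (hP : IsProjInj S P) {E : ShortComplex C} (hE : S E)
    (a : E.X₁ ⟶ P) : ∃ b : E.X₂ ⟶ P, E.f ≫ b = a := hP.1 E hE a

lemma IsProjInj.exists_lift {P : C} (hP : IsProjInj S P) {E : ShortComplex C} (hE : S E)
    (a : P ⟶ E.X₃) : ∃ b : P ⟶ E.X₂, b ≫ E.g = a := hP.2 E hE a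

/-! ### Hulls and the suspension functor -/

namespace Hull

variable (hS : IsFrobenius S)

include hS

lemma exists_map {X X' : C} (H : Hull S X) (H' : Hull S X') (f : X ⟶ X') :
    ∃ (a : H.I ⟶ H'.I) (b : H.Q ⟶ H'.Q), H.ι ≫ a = f ≫ H'.ι ∧ H.π ≫ b = a ≫ H'.π := by
  obtain ⟨a, ha⟩ := H'.projInj.exists_desc H.exact (f ≫ H'.ι)
  dsimp at a ha
  obtain ⟨b, hb⟩ := hS.exists_desc H.exact (a ≫ H'.π) (by
    dsimp
    rw [← Category.assoc, ha, Category.assoc, H'.zero, comp_zero])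
  exact ⟨a, b, ha, hb⟩

/-- If `f = p ≫ q` through `P`, extend `p` to `r` on `H.I`. Then `a - r ≫ q ≫ H'.ι` kills `H.ι`,
hence descends to `s`, and `b = s ≫ H'.π` factors through `H'.I`. -/
lemma map_eq_zero {X X' : C} {H : Hull S X} {H' : Hull S X'} {f : X ⟶ X'} {a : H.I ⟶ H'.I}
    {b : H.Q ⟶ H'.Q} (ha : H.ι ≫ a = f ≫ H'.ι) (hb : H.π ≫ b = a ≫ H'.π)
    (hf : (toStable S).map f = 0) : (toStable S).map b = 0 := by
  rw [toStable_map_eq_zero_iff] at hf ⊢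
  obtain ⟨P, p, q, hP, rfl⟩ := hf
  obtain ⟨r, hr⟩ := hP.exists_desc H.exact p
  dsimp at r hr
  obtain ⟨s, hs⟩ := hS.exists_desc H.exact (a - r ≫ q ≫ H'.ι) (by
    dsimp
    rw [Preadditive.comp_sub, ha, ← hr]
    simp)
  dsimp at s hs
  refine ⟨H'.I, s, H'.π, H'.projInj, ?_⟩
  have := hS.epi H.exact
  dsimp at this
  rw [← cancel_epi H.π, hb, reassoc_of% hs]
  simp [H'.zero]

lemma map_eq {X X' : C} {H : Hull S X} {H' : Hull S X'} {f f' : X ⟶ X'} {a a' : H.I ⟶ H'.I}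
    {b b' : H.Q ⟶ H'.Q} (ha : H.ι ≫ a = f ≫ H'.ι) (hb : H.π ≫ b = a ≫ H'.π)
    (ha' : H.ι ≫ a' = f' ≫ H'.ι) (hb' : H.π ≫ b' = a' ≫ H'.π)
    (hf : (toStable S).map f = (toStable S).map f') :
    (toStable S).map b = (toStable S).map b' := by
  rw [← sub_eq_zero, ← Functor.map_sub] at hf ⊢
  exact map_eq_zero hS (a := a - a') (by simp [ha, ha']) (by simp [hb, hb']) hf

end Hull

/-- The morphism between the last terms of two hulls induced by a morphism between the
first terms. -/
def hullMap (hS : IsFrobenius S) {X X' : C} (H : Hull S X) (H' : Hull S X') (f : X ⟶ X') :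
    (toStable S).obj H.Q ⟶ (toStable S).obj H'.Q :=
  (toStable S).map (H.exists_map hS H' f).choose_spec.choose

section

variable (hS : IsFrobenius S)

lemma hullMap_eq {X X' : C} {H : Hull S X} {H' : Hull S X'} {f : X ⟶ X'} {a : H.I ⟶ H'.I}
    {b : H.Q ⟶ H'.Q} (ha : H.ι ≫ a = f ≫ H'.ι) (hb : H.π ≫ b = a ≫ H'.π) :
    hullMap hS H H' f = (toStable S).map b :=
  Hull.map_eq hS (H.exists_map hS H' f).choose_spec.choose_spec.1
    (H.exists_map hS H' f).choose_spec.choose_spec.2 ha hb rfl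

lemma hullMap_congr {X X' : C} (H : Hull S X) (H' : Hull S X') {f f' : X ⟶ X'}
    (h : (toStable S).map f = (toStable S).map f') : hullMap hS H H' f = hullMap hS H H' f' := by
  obtain ⟨a, b, ha, hb⟩ := H.exists_map hS H' f
  obtain ⟨a', b', ha', hb'⟩ := H.exists_map hS H' f'
  rw [hullMap_eq hS ha hb, hullMap_eq hS ha' hb']
  exact Hull.map_eq hS ha hb ha' hb' h

lemma hullMap_id {X : C} (H : Hull S X) : hullMap hS H H (𝟙 X) = 𝟙 _ := by
  rw [hullMap_eq hS (a := 𝟙 _) (b := 𝟙 _) (by simp) (by simp), CategoryTheory.Functor.map_id]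

lemma hullMap_comp {X X' X'' : C} (H : Hull S X) (H' : Hull S X') (H'' : Hull S X'') (f : X ⟶ X')
    (f' : X' ⟶ X'') :
    hullMap hS H H' f ≫ hullMap hS H' H'' f' = hullMap hS H H'' (f ≫ f') := by
  obtain ⟨a, b, ha, hb⟩ := H.exists_map hS H' f
  obtain ⟨a', b', ha', hb'⟩ := H'.exists_map hS H'' f'
  rw [hullMap_eq hS ha hb, hullMap_eq hS ha' hb', ← Functor.map_comp]
  refine (hullMap_eq hS (a := a ≫ a') ?_ ?_).symm
  · rw [reassoc_of% ha, ha', Category.assoc]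
  · rw [reassoc_of% hb, hb', Category.assoc]

/-- A chosen hull of an object. -/
def IsFrobenius.hull (X : C) : Hull S X := Classical.choice (hS.nonempty_hull X)

/-- The suspension, which takes an object to the last term of its chosen hull. -/
def suspension : StableCategory S ⥤ StableCategory S :=
  CategoryTheory.Quotient.lift (stableRel S)
    { obj := fun X => (toStable S).obj (hS.hull X).Q
      map := fun f => hullMap hS (hS.hull _) (hS.hull _) f
      map_id := fun _ => hullMap_id hS _
      map_comp := fun f g => (hullMap_comp hS _ _ _ f g).symm }
    (fun _ _ f g h => hullMap_congr hS _ _ ((toStable_map_eq_iff f g).2 h))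

lemma suspension_map_toStable_map {X Y : C} (f : X ⟶ Y) :
    (suspension hS).map ((toStable S).map f) = hullMap hS (hS.hull X) (hS.hull Y) f := rfl

/-- The last term of any hull is the suspension of the first one. -/
def suspensionIso (X : C) (H : Hull S X) :
    (toStable S).obj H.Q ≅ (suspension hS).obj ((toStable S).obj X) where
  hom := hullMap hS H (hS.hull X) (𝟙 X)
  inv := hullMap hS (hS.hull X) H (𝟙 X)
  hom_inv_id := by
    refine (hullMap_comp hS _ _ _ _ _).trans ?_
    rw [Category.comp_id, hullMap_id]
  inv_hom_id := by
    refine (hullMap_comp hS _ _ _ _ _).trans ?_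
    rw [Category.comp_id, hullMap_id]
    rfl

lemma suspensionIso_naturality {X X' : C} (H : Hull S X) (H' : Hull S X') (f : X ⟶ X')
    (a : H.I ⟶ H'.I) (b : H.Q ⟶ H'.Q) (ha : H.ι ≫ a = f ≫ H'.ι) (hb : H.π ≫ b = a ≫ H'.π) :
    (toStable S).map b ≫ (suspensionIso hS X' H').hom =
      (suspensionIso hS X H).hom ≫ (suspension hS).map ((toStable S).map f) := by
  rw [← hullMap_eq hS ha hb, suspension_map_toStable_map]
  refine (hullMap_comp hS _ _ _ _ _).trans (Eq.trans ?_ (hullMap_comp hS _ _ _ _ _).symm)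
  rw [Category.comp_id, Category.id_comp]

/-- Dual to `exists_map`: projectivity of the hull lifts `b` to the middle terms, and the lift
restricts to kernels. -/
instance suspension_full : (suspension hS).Full where
  map_surjective := by
    intro X Y φ
    obtain ⟨X, rfl⟩ : ∃ X', (toStable S).obj X' = X := ⟨X.as, rfl⟩
    obtain ⟨Y, rfl⟩ : ∃ Y', (toStable S).obj Y' = Y := ⟨Y.as, rfl⟩
    obtain ⟨b, rfl⟩ := (toStable S).map_surjective (X := (hS.hull X).Q) (Y := (hS.hull Y).Q) φ
    obtain ⟨a, ha⟩ := (hS.hull X).projInj.exists_lift (hS.hull Y).exact ((hS.hull X).π ≫ b)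
    dsimp at a ha
    obtain ⟨f, hf⟩ := hS.exists_lift (hS.hull Y).exact ((hS.hull X).ι ≫ a) (by
      dsimp
      rw [Category.assoc, ha, reassoc_of% (hS.hull X).zero, zero_comp])
    exact ⟨(toStable S).map f, hullMap_eq hS hf.symm ha.symm⟩

/-- If `b - b'` factors through `P`, lifting the second factor to the middle term corrects `a - a'`
so that it lands in `Y`; the resulting `t` restricts along the hull inclusion to `f - g`. -/
instance suspension_faithful : (suspension hS).Faithful where
  map_injective := by
    intro X Y φ ψ h
    obtain ⟨X, rfl⟩ : ∃ X', (toStable S).obj X' = X := ⟨X.as, rfl⟩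
    obtain ⟨Y, rfl⟩ : ∃ Y', (toStable S).obj Y' = Y := ⟨Y.as, rfl⟩
    obtain ⟨f, rfl⟩ := (toStable S).map_surjective φ
    obtain ⟨g, rfl⟩ := (toStable S).map_surjective ψ
    obtain ⟨a, b, ha, hb⟩ := (hS.hull X).exists_map hS (hS.hull Y) f
    obtain ⟨a', b', ha', hb'⟩ := (hS.hull X).exists_map hS (hS.hull Y) g
    have h' : (toStable S).map b = (toStable S).map b' :=
      (hullMap_eq hS ha hb).symm.trans (h.trans (hullMap_eq hS ha' hb'))
    rw [toStable_map_eq_iff] at h' ⊢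
    obtain ⟨P, p, q, hP, hpq⟩ := h'
    obtain ⟨r, hr⟩ := hP.exists_lift (hS.hull Y).exact q
    dsimp at r hr
    obtain ⟨t, ht⟩ := hS.exists_lift (hS.hull Y).exact (a - a' - (hS.hull X).π ≫ p ≫ r) (by
      dsimp
      simp [← hb, ← hb', hr, hpq])
    dsimp at t ht
    refine ⟨(hS.hull X).I, (hS.hull X).ι, t, (hS.hull X).projInj, ?_⟩
    have := hS.mono (hS.hull Y).exact
    dsimp at this
    rw [← cancel_mono (hS.hull Y).ι, Category.assoc, ht]
    simp [ha, ha', reassoc_of% (hS.hull X).zero]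

instance suspension_essSurj : (suspension hS).EssSurj where
  mem_essImage := by
    intro X
    obtain ⟨X, rfl⟩ : ∃ X', (toStable S).obj X' = X := ⟨X.as, rfl⟩
    obtain ⟨W, P, i, p, w, hE, hP⟩ := hS.exists_cohull X
    exact ⟨(toStable S).obj W, ⟨(suspensionIso hS W
      { I := P, Q := X, ι := i, π := p, zero := w, exact := hE, projInj := hP }).symm⟩⟩

instance suspension_isEquivalence : (suspension hS).IsEquivalence where

end

end RelativeExact

/-! ### The shift by the integers given by an autoequivalence -/

namespace CategoryTheory

attribute [local instance] CategoryStruct.toQuiver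

variable {K : Type u} [Category.{v} K]

/-- A `ℤ`-indexed family of objects of which each one is identified with the image of the
preceding one under an endofunctor `F`. -/
structure Tower (F : K ⥤ K) where
  /-- the objects of the tower -/
  obj : ℤ → K
  /-- the identifications between successive objects -/
  iso (n m : ℤ) (h : n + 1 = m) : obj m ≅ F.obj (obj n)

namespace Tower

variable {F : K ⥤ K}

/-- A morphism of towers. -/
@[ext]
structure Hom (X Y : Tower F) where
  /-- the components of a morphism of towers -/
  hom (n : ℤ) : X.obj n ⟶ Y.obj n
  comm (n m : ℤ) (h : n + 1 = m) :
    hom m ≫ (Y.iso n m h).hom = (X.iso n m h).hom ≫ F.map (hom n)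

instance : Category (Tower F) where
  Hom := Hom
  id X := { hom := fun n => 𝟙 _, comm := by simp }
  comp f g :=
    { hom := fun n => f.hom n ≫ g.hom n
      comm := fun n m h => by
        rw [Category.assoc, g.comm, ← Category.assoc, f.comm, Category.assoc, F.map_comp] }

@[ext]
lemma hom_ext {X Y : Tower F} {f g : X ⟶ Y} (h : ∀ n, Hom.hom f n = Hom.hom g n) : f = g :=
  Hom.ext (funext h)

@[simp]
lemma id_hom (X : Tower F) (n : ℤ) : Hom.hom (𝟙 X) n = 𝟙 (X.obj n) := rfl

@[simp]
lemma comp_hom {X Y Z : Tower F} (f : X ⟶ Y) (g : Y ⟶ Z) (n : ℤ) :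
    Hom.hom (f ≫ g) n = Hom.hom f n ≫ Hom.hom g n := rfl

lemma eqToHom_hom {X Y : Tower F} (h : X = Y) (n : ℤ) :
    Hom.hom (eqToHom h) n = eqToHom (by rw [h]) := by
  subst h
  rfl

/-- Evaluation of a tower at an integer. -/
@[simps]
def eval (F : K ⥤ K) (n : ℤ) : Tower F ⥤ K where
  obj X := X.obj n
  map f := Hom.hom f n

/-- Isomorphisms of towers are built from isomorphisms between components. -/
def mkIso {X Y : Tower F} (e : ∀ n, X.obj n ≅ Y.obj n)
    (h : ∀ (n m : ℤ) (h : n + 1 = m),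
      (e m).hom ≫ (Y.iso n m h).hom = (X.iso n m h).hom ≫ F.map (e n).hom) : X ≅ Y where
  hom := { hom := fun n => (e n).hom, comm := h }
  inv :=
    { hom := fun n => (e n).inv
      comm := fun n m hm => by
        rw [Iso.inv_comp_eq, ← Category.assoc, h, Category.assoc, ← F.map_comp]
        simp }

lemma iso_naturality {S T : Tower F} (φ : S ⟶ T) {X Y : K} (a : S.obj 0 ⟶ X) (b : T.obj 0 ⟶ Y)
    (f : X ⟶ Y) (w : Hom.hom φ 0 ≫ b = a ≫ f) :
    Hom.hom φ (0 + 1) ≫ (T.iso 0 (0 + 1) rfl).hom ≫ F.map b =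
      ((S.iso 0 (0 + 1) rfl).hom ≫ F.map a) ≫ F.map f := by
  rw [← Category.assoc, Hom.comm φ 0 (0 + 1) rfl, Category.assoc, Category.assoc, ← F.map_comp,
    w, F.map_comp]

/-- Translation of towers. -/
@[simps]
def translate (F : K ⥤ K) (a : ℤ) : Tower F ⥤ Tower F where
  obj X :=
    { obj := fun n => X.obj (n + a)
      iso := fun n m h => X.iso (n + a) (m + a) (by lia) }
  map f :=
    { hom := fun n => Hom.hom f (n + a)
      comm := fun n m h => Hom.comm f _ _ _ }

/-- Reindexing along equalities of integers is a morphism of towers; this makes translation additive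
up to `eqToHom`. -/
lemma eqToHom_comm (X : Tower F) {n m n' m' : ℤ} (h : n + 1 = m) (h' : n' + 1 = m')
    (hn : n = n') (hm : m = m') :
    eqToHom (congrArg X.obj hm) ≫ (X.iso n' m' h').hom =
      (X.iso n m h).hom ≫ F.map (eqToHom (congrArg X.obj hn)) := by
  subst hn hm
  simp

lemma hom_eqToHom {X Y : Tower F} (f : X ⟶ Y) {n m : ℤ} (h : n = m) :
    Hom.hom f n ≫ eqToHom (congrArg Y.obj h) = eqToHom (congrArg X.obj h) ≫ Hom.hom f m := by
  subst h
  simp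

/-- Translation by zero is the identity. -/
def translateZero (F : K ⥤ K) : translate F 0 ≅ 𝟭 (Tower F) :=
  NatIso.ofComponents (fun X => mkIso (fun n => eqToIso (congrArg X.obj (add_zero n)))
    (fun n m h => X.eqToHom_comm _ _ (add_zero n) (add_zero m)))
    (fun f => by ext n; exact hom_eqToHom f (add_zero n))

/-- Translation by a sum is the composition of translations. -/
def translateAdd (F : K ⥤ K) (a b : ℤ) :
    translate F (a + b) ≅ translate F a ⋙ translate F b :=
  NatIso.ofComponents (fun X => mkIso
      (fun n => eqToIso (congrArg X.obj (by lia : n + (a + b) = n + b + a)))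
      (fun n m h => X.eqToHom_comm _ _ (by lia : n + (a + b) = n + b + a)
        (by lia : m + (a + b) = m + b + a)))
    (fun f => by ext n; exact hom_eqToHom f (by lia : n + (a + b) = n + b + a))

lemma eqToHom_trans_eq {X₁ X₂ X₃ Y Z : K} (h₁ : X₁ = X₂) (h₂ : X₂ = X₃) (h₃ : X₁ = Y)
    (h₄ : Y = Z) (h₅ : Z = X₃) :
    eqToHom h₁ ≫ eqToHom h₂ = eqToHom h₃ ≫ eqToHom h₄ ≫ eqToHom h₅ := by
  simp

lemma translateZero_inv_app_hom (X : Tower F) (n : ℤ) :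
    Hom.hom ((translateZero F).inv.app X) n = eqToHom (congrArg X.obj (add_zero n).symm) := rfl

lemma translateAdd_hom_app_hom (a b : ℤ) (X : Tower F) (n : ℤ) :
    Hom.hom ((translateAdd F a b).hom.app X) n =
      eqToHom (congrArg X.obj (by lia : n + (a + b) = n + b + a)) := rfl

/-- All structure isomorphisms are, componentwise, transports along equalities of integers, so each
coherence condition compares two composites of `eqToHom`. -/
instance : HasShift (Tower F) ℤ :=
  hasShiftMk _ _
    { F := translate F
      zero := translateZero F
      add := translateAdd F
      assoc_hom_app := fun a b c X => by
        ext n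
        simp only [Functor.comp_obj, comp_hom, translate_map_hom, translateAdd_hom_app_hom,
          eqToHom_hom]
        exact eqToHom_trans_eq _ _ _ _ _
      zero_add_hom_app := fun a X => by
        ext n
        simp only [Functor.comp_obj, Functor.id_obj, comp_hom, translate_map_hom,
          translateAdd_hom_app_hom, translateZero_inv_app_hom, eqToHom_hom]
        exact (eqToHom_trans _ _).symm
      add_zero_hom_app := fun a X => by
        ext n
        simp only [Functor.comp_obj, Functor.id_obj, comp_hom, translateAdd_hom_app_hom,
          translateZero_inv_app_hom, eqToHom_hom]
        exact (eqToHom_trans _ _).symm }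

/-! ### Evaluation of towers at zero is an equivalence -/

section

variable {X Y : Tower F} (f : X.obj 0 ⟶ Y.obj 0)

/-- The components in nonnegative degrees of the extension of a morphism to towers. -/
def extendNonneg : ∀ k : ℕ, X.obj (k : ℤ) ⟶ Y.obj (k : ℤ)
  | 0 => f
  | k + 1 => (X.iso k (k + 1 : ℕ) (by lia)).hom ≫ F.map (extendNonneg k) ≫
      (Y.iso k (k + 1 : ℕ) (by lia)).inv

variable [F.Full]

/-- The components in negative degrees of the extension of a morphism to towers. -/
def extendNeg : ∀ k : ℕ, X.obj (Int.negSucc k) ⟶ Y.obj (Int.negSucc k)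
  | 0 => F.preimage ((X.iso (Int.negSucc 0) 0 (by lia)).inv ≫ f ≫
      (Y.iso (Int.negSucc 0) 0 (by lia)).hom)
  | k + 1 => F.preimage ((X.iso (Int.negSucc (k + 1)) (Int.negSucc k) (by lia)).inv ≫
      extendNeg k ≫ (Y.iso (Int.negSucc (k + 1)) (Int.negSucc k) (by lia)).hom)

/-- The components of the extension of a morphism to towers. -/
def extendHom : ∀ n : ℤ, X.obj n ⟶ Y.obj n
  | Int.ofNat k => extendNonneg f k
  | Int.negSucc k => extendNeg f k

/-- The extension to towers of a morphism between the objects in degree `0`. -/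
def extend : X ⟶ Y where
  hom := extendHom f
  comm n m h := by
    rcases n with k | k
    · obtain rfl : m = Int.ofNat (k + 1) := by rw [← h]; rfl
      simp only [extendHom, extendNonneg]
      erw [Category.assoc, Category.assoc, Iso.inv_hom_id, Category.comp_id]
      rfl
    · rcases k with _ | k
      · obtain rfl : m = Int.ofNat 0 := by rw [← h]; rfl
        simp only [extendHom, extendNeg, extendNonneg, Functor.map_preimage]
        erw [Iso.hom_inv_id_assoc]
        rfl
      · obtain rfl : m = Int.negSucc k := by lia
        simp [extendHom, extendNeg]

end

/-- Upwards the components are forced by the tower isomorphisms; downwards, faithfulness of `F`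
cancels it. -/
lemma hom_eq_of_eval_zero [F.Faithful] {X Y : Tower F} {f g : X ⟶ Y}
    (h : Hom.hom f 0 = Hom.hom g 0) : f = g := by
  ext n
  induction n using Int.induction_on with
  | zero => exact h
  | succ k ih =>
    rw [← cancel_mono (Y.iso k (k + 1) rfl).hom, Hom.comm, Hom.comm, ih]
  | pred k ih =>
    apply F.map_injective
    rw [← cancel_epi (X.iso (-k - 1) (-k) (by lia)).hom, ← Hom.comm, ← Hom.comm, ih]

instance [F.Full] : (eval F 0).Full where
  map_surjective f := ⟨extend f, rfl⟩

instance [F.Faithful] : (eval F 0).Faithful where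
  map_injective h := hom_eq_of_eval_zero h

section

variable [F.EssSurj]

variable (F) in
/-- The objects in nonnegative degrees of a tower with a given object in degree `0`. -/
def iterate (X : K) : ℕ → K
  | 0 => X
  | k + 1 => F.obj (iterate X k)

variable (F) in
/-- The objects in negative degrees of a tower with a given object in degree `0`. -/
def iteratePreimage (X : K) : ℕ → K
  | 0 => F.objPreimage X
  | k + 1 => F.objPreimage (iteratePreimage X k)

variable (F) in
/-- The objects of a tower with a given object in degree `0`. -/
def ofObjObj (X : K) : ℤ → K
  | Int.ofNat k => iterate F X k
  | Int.negSucc k => iteratePreimage F X k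

variable (F) in
/-- The identification of each object with the image of the preceding one. -/
def ofObjIso (X : K) : ∀ n : ℤ, ofObjObj F X (n + 1) ≅ F.obj (ofObjObj F X n)
  | Int.ofNat _ => Iso.refl _
  | Int.negSucc 0 => (F.objObjPreimageIso X).symm
  | Int.negSucc (k + 1) => (F.objObjPreimageIso (iteratePreimage F X k)).symm

variable (F) in
/-- A tower with a given object in degree `0`. -/
def ofObj (X : K) : Tower F where
  obj := ofObjObj F X
  iso n _ h := eqToIso (congrArg _ h.symm) ≪≫ ofObjIso F X n

instance : (eval F 0).EssSurj where
  mem_essImage X := ⟨ofObj F X, ⟨Iso.refl _⟩⟩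

end

instance [F.IsEquivalence] : (eval F 0).IsEquivalence where

end Tower

variable (F : K ⥤ K) [F.IsEquivalence]

/-- The shift by `ℤ` in which the shift by `1` is a given autoequivalence. -/
@[reducible]
def hasShiftOfIsEquivalence : HasShift K ℤ :=
  HasShift.induced (Tower.eval F 0) ℤ
    (fun n => (Tower.eval F 0).inv ⋙ shiftFunctor _ n ⋙ Tower.eval F 0)
    (fun _ => (Functor.associator _ _ _).symm ≪≫
      Functor.isoWhiskerRight (Tower.eval F 0).asEquivalence.unitIso.symm _ ≪≫
      Functor.leftUnitor _)

/-- The shift by `1` defined by an autoequivalence is isomorphic to that autoequivalence. -/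
def shiftFunctorOneIso :
    letI := hasShiftOfIsEquivalence F
    shiftFunctor K (1 : ℤ) ≅ F :=
  -- Shifting by `1` means evaluating a tower over `X` in degree `0 + 1`, which the tower identifies
  -- with `F` of its degree `0` term, itself isomorphic to `X` by the counit.
  NatIso.ofComponents (F := (Tower.eval F 0).inv ⋙ Tower.translate F 1 ⋙ Tower.eval F 0)
    (fun X => (((Tower.eval F 0).inv.obj X).iso 0 (0 + 1) rfl) ≪≫
      F.mapIso ((Tower.eval F 0).asEquivalence.counitIso.app X))
    (fun f => Tower.iso_naturality ((Tower.eval F 0).inv.map f) _ _ f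
      ((Tower.eval F 0).asEquivalence.counitIso.hom.naturality f))

/-- Shift functors are equivalences, so they preserve biproducts and hence addition of morphisms;
the suspension need not be inspected. -/
lemma shiftFunctor_additive [Preadditive K] [HasFiniteBiproducts K] [HasShift K ℤ] (n : ℤ) :
    (shiftFunctor K n).Additive := by
  have := hasBinaryBiproducts_of_finite_biproducts K
  have := preservesBinaryBiproducts_of_preservesBinaryProducts (shiftFunctor K n)
  exact Functor.additive_of_preservesBinaryBiproducts _

end CategoryTheory

/-! ### The triangulated structure on the stable category -/

namespace RelativeExact

variable {C : Type u} [Category.{v} C] [Preadditive C] [HasFiniteBiproducts C]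

attribute [local instance] CategoryStruct.toQuiver hasBinaryBiproducts_of_finite_biproducts

variable {S : ObjectProperty (ShortComplex C)}

/-- Isomorphisms of triangles are built from isomorphisms between their objects. -/
def triangleMkIso {K : Type u} [Category.{v} K] [HasShift K ℤ] {X Y Z X' Y' Z' : K} {f : X ⟶ Y}
    {g : Y ⟶ Z} {h : Z ⟶ X⟦(1 : ℤ)⟧} {f' : X' ⟶ Y'} {g' : Y' ⟶ Z'} {h' : Z' ⟶ X'⟦(1 : ℤ)⟧}
    (e₁ : X ≅ X') (e₂ : Y ≅ Y') (e₃ : Z ≅ Z') (w₁ : f ≫ e₂.hom = e₁.hom ≫ f')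
    (w₂ : g ≫ e₃.hom = e₂.hom ≫ g') (w₃ : h ≫ e₁.hom⟦(1 : ℤ)⟧' = e₃.hom ≫ h') :
    Triangle.mk f g h ≅ Triangle.mk f' g' h' :=
  Triangle.isoMk _ _ e₁ e₂ e₃ w₁ w₂ w₃

lemma exists_triangle_hom_of_iso {K : Type u} [Category.{v} K] [HasShift K ℤ]
    {T T' U U' : Triangle K} (i : T ≅ U) (i' : T' ≅ U')
    (H : ∀ (a : U.obj₁ ⟶ U'.obj₁) (b : U.obj₂ ⟶ U'.obj₂), U.mor₁ ≫ b = a ≫ U'.mor₁ →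
      ∃ φ : U ⟶ U', φ.hom₁ = a ∧ φ.hom₂ = b)
    (a : T.obj₁ ⟶ T'.obj₁) (b : T.obj₂ ⟶ T'.obj₂) (w : T.mor₁ ≫ b = a ≫ T'.mor₁) :
    ∃ φ : T ⟶ T', φ.hom₁ = a ∧ φ.hom₂ = b := by
  obtain ⟨φ, h₁, h₂⟩ := H (i.inv.hom₁ ≫ a ≫ i'.hom.hom₁) (i.inv.hom₂ ≫ b ≫ i'.hom.hom₂) (by
    rw [i.inv.comm₁_assoc, reassoc_of% w, i'.hom.comm₁]
    simp)
  refine ⟨i.hom ≫ φ ≫ i'.inv, ?_, ?_⟩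
  · rw [comp_hom₁, comp_hom₁, h₁]
    simp
  · rw [comp_hom₂, comp_hom₂, h₂]
    simp

lemma exists_eq_mor₂_comp_of_iso {K : Type u} [Category.{v} K] [HasZeroMorphisms K]
    [HasShift K ℤ] {T U : Triangle K} (i : T ≅ U) {W : K}
    (H : ∀ x : U.obj₂ ⟶ W, U.mor₁ ≫ x = 0 → ∃ y : U.obj₃ ⟶ W, x = U.mor₂ ≫ y)
    (x : T.obj₂ ⟶ W) (hx : T.mor₁ ≫ x = 0) : ∃ y : T.obj₃ ⟶ W, x = T.mor₂ ≫ y := by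
  obtain ⟨y, hy⟩ := H (i.inv.hom₂ ≫ x) (by rw [i.inv.comm₁_assoc, hx, comp_zero])
  exact ⟨i.hom.hom₃ ≫ y, by rw [i.hom.comm₂_assoc, ← hy, Iso.hom_inv_id_triangle_hom₂_assoc]⟩

/-- The defect of commutativity factors through some `P`; its first factor extends along the
inflation `E.f`, so the defect is absorbed by changing `b` within its stable class. -/
lemma IsFrobenius.exists_hom (hS : IsFrobenius S) {E E' : ShortComplex C} (hE : S E)
    (a : E.X₁ ⟶ E'.X₁) (b : E.X₂ ⟶ E'.X₂)
    (h : (toStable S).map (E.f ≫ b) = (toStable S).map (a ≫ E'.f)) :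
    ∃ τ : E ⟶ E', τ.τ₁ = a ∧ (toStable S).map τ.τ₂ = (toStable S).map b := by
  rw [toStable_map_eq_iff] at h
  obtain ⟨P, p, q, hP, hpq⟩ := h
  obtain ⟨r, hr⟩ := hP.exists_desc hE p
  have w : E.f ≫ (b - r ≫ q) = a ≫ E'.f := by
    rw [Preadditive.comp_sub, reassoc_of% hr, hpq, sub_sub_cancel]
  obtain ⟨c, hc⟩ := hS.exists_desc hE ((b - r ≫ q) ≫ E'.g) (by
    rw [reassoc_of% w, ShortComplex.zero, comp_zero])
  exact ⟨{ τ₁ := a, τ₂ := b - r ≫ q, τ₃ := c, comm₁₂ := w.symm, comm₂₃ := hc.symm }, rfl,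
    (toStable_map_eq hP r q (by simp)).symm⟩

lemma isIso_toStable_map_fst (Y : C) {P : C} (hP : IsProjInj S P) :
    IsIso ((toStable S).map (biprod.fst : Y ⊞ P ⟶ Y)) := by
  refine ⟨(toStable S).map biprod.inl, ?_, ?_⟩
  · rw [← Functor.map_comp, ← CategoryTheory.Functor.map_id]
    refine (toStable_map_eq hP biprod.snd biprod.inr ?_).symm
    rw [biprod.total]
  · rw [← Functor.map_comp, biprod.inl_fst, CategoryTheory.Functor.map_id]

lemma isIso_toStable_map_inl (Y : C) {P : C} (hP : IsProjInj S P) :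
    IsIso ((toStable S).map (biprod.inl : Y ⟶ Y ⊞ P)) := by
  have := isIso_toStable_map_fst Y hP
  have h : (toStable S).map (biprod.inl : Y ⟶ Y ⊞ P) ≫ (toStable S).map biprod.fst = 𝟙 _ := by
    rw [← Functor.map_comp, biprod.inl_fst, CategoryTheory.Functor.map_id]
  rw [← IsIso.eq_comp_inv, Category.id_comp] at h
  rw [h]
  infer_instance

/-- The mapping cylinder: `f` becomes `(f, ι) : X ⟶ Y ⊞ I` for a hull `I` of `X`, and projecting
away `I` is a stable isomorphism. -/
lemma IsFrobenius.exists_inflation (hS : IsFrobenius S) {X Y : C} (f : X ⟶ Y) :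
    ∃ (Y' : C) (f' : X ⟶ Y') (p : Y' ⟶ Y) (Z : C) (g : Y' ⟶ Z) (w : f' ≫ g = 0),
      S (ShortComplex.mk f' g w) ∧ f' ≫ p = f ∧ IsIso ((toStable S).map p) := by
  obtain ⟨Q, q, w, h⟩ := hS.exists_biprod_lift (hS.hull X).exact f
  exact ⟨_, _, biprod.fst, Q, q, w, h, by simp, isIso_toStable_map_fst _ (hS.hull X).projInj⟩

/-! ### Connecting morphisms and the pretriangulated axioms -/

variable [HasShift (StableCategory S) ℤ]
  {e : ∀ (X : C) (H : Hull S X), (toStable S).obj H.Q ≅ ((toStable S).obj X)⟦(1 : ℤ)⟧}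

/-- The triangle in the stable category given by a short sequence and a connecting morphism. -/
abbrev stableTriangle (E : ShortComplex C)
    (h : (toStable S).obj E.X₃ ⟶ ((toStable S).obj E.X₁)⟦(1 : ℤ)⟧) :
    Triangle (StableCategory S) :=
  Triangle.mk ((toStable S).map E.f) ((toStable S).map E.g) h

lemma exists_isInducedBy (hS : IsFrobenius S) {E : ShortComplex C} (hE : S E) :
    ∃ h, IsInducedBy e E h := by
  obtain ⟨j, hj⟩ := (hS.hull E.X₁).projInj.exists_desc hE (hS.hull E.X₁).ι
  obtain ⟨k, hk⟩ := hS.exists_desc hE (j ≫ (hS.hull E.X₁).π) (by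
    rw [reassoc_of% hj, Hull.zero])
  exact ⟨_, hS.hull E.X₁, j, k, hj, hk, rfl⟩

/-- The maps `j ≫ a` and `τ.τ₂ ≫ j'` agree on `E.X₁`, so they differ by `E.g ≫ s`. Hence `k ≫ b` and
`τ.τ₃ ≫ k'` differ by `s ≫ H'.π`, which is stably zero. -/
lemma IsInducedBy.naturality (hS : IsFrobenius S) (he : IsNaturalSuspension e)
    {E E' : ShortComplex C} (hE : S E)
    {h : (toStable S).obj E.X₃ ⟶ ((toStable S).obj E.X₁)⟦(1 : ℤ)⟧}
    {h' : (toStable S).obj E'.X₃ ⟶ ((toStable S).obj E'.X₁)⟦(1 : ℤ)⟧}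
    (hh : IsInducedBy e E h) (hh' : IsInducedBy e E' h') (τ : E ⟶ E') :
    h ≫ ((toStable S).map τ.τ₁)⟦(1 : ℤ)⟧' = (toStable S).map τ.τ₃ ≫ h' := by
  obtain ⟨H, j, k, hj, hk, rfl⟩ := hh
  obtain ⟨H', j', k', hj', hk', rfl⟩ := hh'
  obtain ⟨a, b, ha, hb⟩ := H.exists_map hS H' τ.τ₁
  obtain ⟨s, hs⟩ := hS.exists_desc hE (j ≫ a - τ.τ₂ ≫ j') (by
    rw [Preadditive.comp_sub, reassoc_of% hj, ha, ← τ.comm₁₂_assoc, hj', sub_self])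
  have := hS.epi hE
  rw [Category.assoc, ← he H H' τ.τ₁ a b ha hb, ← Category.assoc, ← Category.assoc,
    ← Functor.map_comp, ← Functor.map_comp]
  congr 1
  refine toStable_map_eq H'.projInj s H'.π ?_
  rw [← cancel_epi E.g, reassoc_of% hk, hb, Preadditive.comp_add, reassoc_of% hs,
    ← τ.comm₂₃_assoc, hk']
  simp

lemma IsInducedBy.unique (hS : IsFrobenius S) (he : IsNaturalSuspension e)
    {E : ShortComplex C} (hE : S E)
    {h h' : (toStable S).obj E.X₃ ⟶ ((toStable S).obj E.X₁)⟦(1 : ℤ)⟧}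
    (hh : IsInducedBy e E h) (hh' : IsInducedBy e E h') : h = h' := by
  simpa using IsInducedBy.naturality hS he hE hh hh' (𝟙 E)

/-- The morphism of triangles induced by a morphism of short exact sequences. -/
@[simps]
def stableTriangleMap (hS : IsFrobenius S) (he : IsNaturalSuspension e)
    {E E' : ShortComplex C} (hE : S E)
    {h : (toStable S).obj E.X₃ ⟶ ((toStable S).obj E.X₁)⟦(1 : ℤ)⟧}
    {h' : (toStable S).obj E'.X₃ ⟶ ((toStable S).obj E'.X₁)⟦(1 : ℤ)⟧}
    (hh : IsInducedBy e E h) (hh' : IsInducedBy e E' h') (τ : E ⟶ E') :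
    stableTriangle E h ⟶ stableTriangle E' h' where
  hom₁ := (toStable S).map τ.τ₁
  hom₂ := (toStable S).map τ.τ₂
  hom₃ := (toStable S).map τ.τ₃
  comm₁ := by
    change (toStable S).map E.f ≫ (toStable S).map τ.τ₂ =
      (toStable S).map τ.τ₁ ≫ (toStable S).map E'.f
    rw [← Functor.map_comp, ← Functor.map_comp, τ.comm₁₂]
  comm₂ := by
    change (toStable S).map E.g ≫ (toStable S).map τ.τ₃ =
      (toStable S).map τ.τ₂ ≫ (toStable S).map E'.g
    rw [← Functor.map_comp, ← Functor.map_comp, τ.comm₂₃]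
  comm₃ := IsInducedBy.naturality hS he hE hh hh' τ

variable (e) in
/-- The triangles isomorphic to one given by a sequence of the class `S`. -/
def stableDistinguished : Set (Triangle (StableCategory S)) :=
  fun T => ∃ (E : ShortComplex C) (h : (toStable S).obj E.X₃ ⟶ ((toStable S).obj E.X₁)⟦(1 : ℤ)⟧),
    S E ∧ IsInducedBy e E h ∧ Nonempty (T ≅ stableTriangle E h)

lemma stableTriangle_mem {E : ShortComplex C} (hE : S E)
    {h : (toStable S).obj E.X₃ ⟶ ((toStable S).obj E.X₁)⟦(1 : ℤ)⟧} (hh : IsInducedBy e E h) :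
    stableTriangle E h ∈ stableDistinguished e :=
  ⟨E, h, hE, hh, ⟨Iso.refl _⟩⟩

lemma stableDistinguished_of_iso {T T' : Triangle (StableCategory S)}
    (hT : T ∈ stableDistinguished e) (i : T' ≅ T) : T' ∈ stableDistinguished e := by
  obtain ⟨E, h, hE, hh, ⟨φ⟩⟩ := hT
  exact ⟨E, h, hE, hh, ⟨i ≪≫ φ⟩⟩

lemma exists_stableDistinguished (hS : IsFrobenius S) {X Y : StableCategory S} (f : X ⟶ Y) :
    ∃ (Z : StableCategory S) (g : Y ⟶ Z) (h : Z ⟶ X⟦(1 : ℤ)⟧),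
      Triangle.mk f g h ∈ stableDistinguished e := by
  obtain ⟨X, rfl⟩ : ∃ X', (toStable S).obj X' = X := ⟨X.as, rfl⟩
  obtain ⟨Y, rfl⟩ : ∃ Y', (toStable S).obj Y' = Y := ⟨Y.as, rfl⟩
  obtain ⟨f, rfl⟩ := (toStable S).map_surjective f
  obtain ⟨Y', f', p, Z, g, w, hE, rfl, hp⟩ := hS.exists_inflation f
  obtain ⟨h, hh⟩ := exists_isInducedBy (e := e) hS hE
  refine ⟨_, inv ((toStable S).map p) ≫ (toStable S).map g, h, _, _, hE, hh, ⟨?_⟩⟩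
  exact triangleMkIso (Iso.refl _) (asIso ((toStable S).map p)).symm (Iso.refl _)
    (by simp) (by simp) (by simp)

lemma exists_triangle_hom (hS : IsFrobenius S) (he : IsNaturalSuspension e)
    {T T' : Triangle (StableCategory S)} (hT : T ∈ stableDistinguished e)
    (hT' : T' ∈ stableDistinguished e) (a : T.obj₁ ⟶ T'.obj₁) (b : T.obj₂ ⟶ T'.obj₂)
    (w : T.mor₁ ≫ b = a ≫ T'.mor₁) : ∃ φ : T ⟶ T', φ.hom₁ = a ∧ φ.hom₂ = b := by
  obtain ⟨E, h, hE, hh, ⟨i⟩⟩ := hT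
  obtain ⟨E', h', hE', hh', ⟨i'⟩⟩ := hT'
  refine exists_triangle_hom_of_iso i i' ?_ a b w
  intro (a : (toStable S).obj E.X₁ ⟶ (toStable S).obj E'.X₁)
    (b : (toStable S).obj E.X₂ ⟶ (toStable S).obj E'.X₂)
    (w : (toStable S).map E.f ≫ b = a ≫ (toStable S).map E'.f)
  obtain ⟨a, rfl⟩ := (toStable S).map_surjective a
  obtain ⟨b, rfl⟩ := (toStable S).map_surjective b
  obtain ⟨τ, rfl, hτ⟩ := hS.exists_hom hE a b (by rw [Functor.map_comp, w, Functor.map_comp])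
  exact ⟨stableTriangleMap hS he hE hh hh' τ, rfl, hτ⟩

lemma contractibleTriangle_mem (hS : IsFrobenius S) (X : StableCategory S) :
    contractibleTriangle X ∈ stableDistinguished e := by
  obtain ⟨X, rfl⟩ : ∃ X', (toStable S).obj X' = X := ⟨X.as, rfl⟩
  obtain ⟨Z, hZ⟩ := HasZeroObject.zero (C := C)
  have hE := hS.of_isZero X hZ
  obtain ⟨h, hh⟩ := exists_isInducedBy (e := e) hS hE
  have hZ' : IsZero ((toStable S).obj Z) := (toStable S).map_isZero hZ
  exact ⟨_, h, hE, hh, ⟨triangleMkIso (Iso.refl _) (Iso.refl _) hZ'.isoZero.symm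
    (by simp) (hZ'.eq_of_tgt _ _) ((isZero_zero _).eq_of_src _ _)⟩⟩

/-- Exactness of `Hom(-, W)` at the middle term: a stably zero composite is made strictly zero as in
`exists_hom`, and then descends to the cokernel. -/
lemma exists_eq_mor₂_comp {T : Triangle (StableCategory S)} (hS : IsFrobenius S)
    (hT : T ∈ stableDistinguished e) {W : StableCategory S} (x : T.obj₂ ⟶ W)
    (hx : T.mor₁ ≫ x = 0) : ∃ y : T.obj₃ ⟶ W, x = T.mor₂ ≫ y := by
  obtain ⟨E, h, hE, hh, ⟨i⟩⟩ := hT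
  refine exists_eq_mor₂_comp_of_iso i ?_ x hx
  obtain ⟨W, rfl⟩ : ∃ W', (toStable S).obj W' = W := ⟨W.as, rfl⟩
  intro (x : (toStable S).obj E.X₂ ⟶ (toStable S).obj W) (hx : (toStable S).map E.f ≫ x = 0)
  obtain ⟨x, rfl⟩ := (toStable S).map_surjective x
  rw [← Functor.map_comp, toStable_map_eq_zero_iff] at hx
  obtain ⟨P, p, q, hP, hpq⟩ := hx
  obtain ⟨r, hr⟩ := hP.exists_desc hE p
  obtain ⟨y, hy⟩ := hS.exists_desc hE (x - r ≫ q) (by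
    rw [Preadditive.comp_sub, reassoc_of% hr, hpq, sub_self])
  refine ⟨(toStable S).map y, Eq.trans ?_ ((toStable S).map_comp E.g y)⟩
  rw [hy]
  exact toStable_map_eq hP r q (by simp)

/-- For a sequence `X ⟶ Y ⟶ Z` with connecting data `j`, `k` into a hull `X ⟶ I ⟶ Q`, the rotated
triangle is the one of `Y ⟶ Z ⊞ I ⟶ Q`, because `Z ⊞ I` is stably `Z` and `Q` is the suspension of
`X`. -/
lemma rotate_mem (hS : IsFrobenius S) (he : IsNaturalSuspension e)
    {T : Triangle (StableCategory S)} (hT : T ∈ stableDistinguished e) :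
    T.rotate ∈ stableDistinguished e := by
  obtain ⟨E, h, hE, hh, ⟨i⟩⟩ := hT
  refine stableDistinguished_of_iso ?_ ((rotate _).mapIso i)
  obtain ⟨H, j, k, hj, hk, rfl⟩ := hh
  obtain ⟨a, b, ha, hb⟩ := H.exists_map hS (hS.hull E.X₂) E.f
  obtain ⟨c, hc⟩ := hS.exists_desc hE ((hS.hull E.X₂).ι - j ≫ a) (by
    rw [Preadditive.comp_sub, reassoc_of% hj, ha, sub_self])
  have hE' := hS.biprod_lift_desc hE H.exact j k hj hk
  have hepi := hS.epi hE
  have := isIso_toStable_map_inl (S := S) E.X₃ H.projInj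
  -- The component `-H.π` of the deflation forces `-b` rather than `b`; this is the sign in the
  -- rotated triangle.
  refine ⟨_, (toStable S).map (-b) ≫ (e E.X₂ (hS.hull E.X₂)).hom, hE',
    ⟨hS.hull E.X₂, biprod.desc c a, -b, ?_, ?_, rfl⟩, ⟨?_⟩⟩
  · dsimp
    rw [biprod.lift_desc, hc, sub_add_cancel]
  · dsimp
    ext
    · rw [← cancel_epi E.g]
      simp [reassoc_of% hc, reassoc_of% hk, hb, Hull.zero]
    · simp [hb]
  · let α := asIso ((toStable S).map (biprod.inl : E.X₃ ⟶ E.X₃ ⊞ H.I))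
    refine triangleMkIso (Iso.refl _) α (e E.X₁ H).symm ?_ ?_ ?_
    · rw [asIso_hom]
      refine ((toStable S).map_comp E.g biprod.inl).symm.trans ?_
      -- `biprod.lift E.g j` and `E.g ≫ biprod.inl` differ by `j ≫ biprod.inr`, which factors
      -- through `H.I`.
      refine (toStable_map_eq H.projInj j biprod.inr ?_).symm.trans (Category.id_comp _).symm
      dsimp
      ext <;> simp
    · change ((toStable S).map k ≫ (e E.X₁ H).hom) ≫ (e E.X₁ H).inv =
        (toStable S).map biprod.inl ≫ (toStable S).map (biprod.desc k (-H.π))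
      rw [← Functor.map_comp, biprod.inl_desc, Category.assoc, Iso.hom_inv_id, Category.comp_id]
    · change (-((toStable S).map E.f)⟦(1 : ℤ)⟧') ≫ (𝟙 ((toStable S).obj E.X₂))⟦(1 : ℤ)⟧' =
        (e E.X₁ H).inv ≫ (toStable S).map (-b) ≫ (e E.X₂ (hS.hull E.X₂)).hom
      rw [Functor.map_neg, Preadditive.neg_comp, Preadditive.neg_comp,
        he H (hS.hull E.X₂) E.f a b ha hb]
      simp

variable [∀ n : ℤ, (shiftFunctor (StableCategory S) n).Additive]

lemma exists_eq_mor₃_comp {T : Triangle (StableCategory S)} (hS : IsFrobenius S)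
    (he : IsNaturalSuspension e) (hT : T ∈ stableDistinguished e) {W : StableCategory S}
    (x : T.obj₃ ⟶ W) (hx : T.mor₂ ≫ x = 0) : ∃ y : T.obj₁⟦(1 : ℤ)⟧ ⟶ W, x = T.mor₃ ≫ y :=
  exists_eq_mor₂_comp (T := T.rotate) hS (rotate_mem hS he hT) x hx

/-- The difference `φ.hom₃ - 𝟙` factors through `T.mor₃` and is killed by composing with `T.mor₃`,
so it squares to zero and `2 - φ.hom₃` is the inverse. Only exactness of contravariant `Hom` is
needed. -/
lemma isIso_hom₃_of_endomorphism {T : Triangle (StableCategory S)} (hS : IsFrobenius S)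
    (he : IsNaturalSuspension e) (hT : T ∈ stableDistinguished e) (φ : T ⟶ T)
    (h₁ : φ.hom₁ = 𝟙 _) (h₂ : φ.hom₂ = 𝟙 _) : IsIso φ.hom₃ := by
  have c₂ := φ.comm₂
  have c₃ := φ.comm₃
  rw [h₂, Category.id_comp] at c₂
  rw [h₁, CategoryTheory.Functor.map_id, Category.comp_id] at c₃
  obtain ⟨y, hy⟩ := exists_eq_mor₃_comp hS he hT (φ.hom₃ - 𝟙 _) (by
    rw [Preadditive.comp_sub, c₂, Category.comp_id, sub_self])
  have h : (φ.hom₃ - 𝟙 _) ≫ (φ.hom₃ - 𝟙 _) = 0 := by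
    nth_rw 2 [hy]
    rw [← Category.assoc, Preadditive.sub_comp, ← c₃, Category.id_comp, sub_self, zero_comp]
  have h' : φ.hom₃ ≫ φ.hom₃ = φ.hom₃ + φ.hom₃ - 𝟙 _ := by
    simp only [Preadditive.comp_sub, Preadditive.sub_comp, Category.id_comp,
      Category.comp_id] at h
    rw [sub_sub, sub_eq_zero] at h
    rw [h]
    abel
  refine ⟨𝟙 _ + 𝟙 _ - φ.hom₃, ?_, ?_⟩
  · simp only [Preadditive.comp_sub, Preadditive.comp_add, Category.comp_id, h']
    abel
  · simp only [Preadditive.sub_comp, Preadditive.add_comp, Category.id_comp, h']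
    abel

lemma isIso_hom₃ {T T' : Triangle (StableCategory S)} (hS : IsFrobenius S)
    (he : IsNaturalSuspension e) (hT : T ∈ stableDistinguished e)
    (hT' : T' ∈ stableDistinguished e) (φ : T ⟶ T') [IsIso φ.hom₁] [IsIso φ.hom₂] :
    IsIso φ.hom₃ := by
  obtain ⟨ψ, h₁, h₂⟩ := exists_triangle_hom hS he hT' hT (inv φ.hom₁) (inv φ.hom₂)
    (by rw [IsIso.comp_inv_eq, Category.assoc, φ.comm₁, IsIso.inv_hom_id_assoc])
  have i : IsIso (φ ≫ ψ).hom₃ :=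
    isIso_hom₃_of_endomorphism hS he hT _ (by simp [h₁]) (by simp [h₂])
  have i' : IsIso (ψ ≫ φ).hom₃ :=
    isIso_hom₃_of_endomorphism hS he hT' _ (by simp [h₁]) (by simp [h₂])
  rw [comp_hom₃] at i i'
  have := mono_of_mono φ.hom₃ ψ.hom₃
  have : IsSplitEpi φ.hom₃ := ⟨⟨inv (ψ.hom₃ ≫ φ.hom₃) ≫ ψ.hom₃, by simp⟩⟩
  exact isIso_of_mono_of_isSplitEpi _

/-- Complete `T.mor₁` to a distinguished triangle. The threefold rotations of both triangles are
distinguished with the same first morphism, so their third terms are isomorphic; this isomorphism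
desuspends, and the three signs cancel. -/
lemma mem_of_rotate_mem {T : Triangle (StableCategory S)} (hS : IsFrobenius S)
    (he : IsNaturalSuspension e) (hT : T.rotate ∈ stableDistinguished e) :
    T ∈ stableDistinguished e := by
  obtain ⟨Z, g, h, hT'⟩ := exists_stableDistinguished (e := e) hS T.mor₁
  have h₁ := rotate_mem hS he (rotate_mem hS he hT)
  have h₂ := rotate_mem hS he (rotate_mem hS he (rotate_mem hS he hT'))
  obtain ⟨φ, w₁, w₂⟩ := exists_triangle_hom hS he h₁ h₂ (𝟙 _) (𝟙 _)
    ((Category.comp_id _).trans (Category.id_comp _).symm)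
  have : IsIso φ.hom₁ := by rw [w₁]; exact IsIso.id _
  have : IsIso φ.hom₂ := by rw [w₂]; exact IsIso.id _
  have := isIso_hom₃ hS he h₁ h₂ φ
  obtain ⟨c, hc⟩ := (shiftFunctor (StableCategory S) (1 : ℤ)).map_surjective (X := T.obj₃) (Y := Z)
    φ.hom₃
  have : IsIso ((shiftFunctor (StableCategory S) (1 : ℤ)).map c) := by rw [hc]; assumption
  have := isIso_of_reflects_iso c (shiftFunctor (StableCategory S) (1 : ℤ))
  have c₂ : (-(T.mor₂⟦(1 : ℤ)⟧')) ≫ c⟦(1 : ℤ)⟧' = 𝟙 _ ≫ (-(g⟦(1 : ℤ)⟧')) := by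
    have := φ.comm₂
    rw [w₂, ← hc] at this
    exact this
  have c₃ : (-(T.mor₃⟦(1 : ℤ)⟧')) ≫ (𝟙 (T.obj₁⟦(1 : ℤ)⟧))⟦(1 : ℤ)⟧' =
      c⟦(1 : ℤ)⟧' ≫ (-(h⟦(1 : ℤ)⟧')) := by
    have := φ.comm₃
    rw [w₁, ← hc] at this
    exact this
  rw [Category.id_comp, Preadditive.neg_comp, neg_inj, ← Functor.map_comp] at c₂
  rw [CategoryTheory.Functor.map_id, Category.comp_id, Preadditive.comp_neg, neg_inj,
    ← Functor.map_comp] at c₃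
  refine stableDistinguished_of_iso hT'
    (triangleMkIso (f := T.mor₁) (g := T.mor₂) (h := T.mor₃) (Iso.refl _) (Iso.refl _) (asIso c)
      (by simp) ?_ ?_)
  · rw [Iso.refl_hom, Category.id_comp]
    exact (shiftFunctor (StableCategory S) (1 : ℤ)).map_injective c₂
  · rw [Iso.refl_hom, CategoryTheory.Functor.map_id, Category.comp_id]
    exact (shiftFunctor (StableCategory S) (1 : ℤ)).map_injective c₃

/-- The pretriangulated structure on the stable category. -/
@[reducible]
def pretriangulated (hS : IsFrobenius S) (he : IsNaturalSuspension e) :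
    Pretriangulated (StableCategory S) where
  distinguishedTriangles := stableDistinguished e
  isomorphic_distinguished _ hT _ i := stableDistinguished_of_iso hT i
  contractible_distinguished := contractibleTriangle_mem hS
  distinguished_cocone_triangle f := exists_stableDistinguished hS f
  rotate_distinguished_triangle _ := ⟨rotate_mem hS he, mem_of_rotate_mem hS he⟩
  complete_distinguished_triangle_morphism T T' hT hT' a b w := by
    obtain ⟨φ, rfl, rfl⟩ := exists_triangle_hom hS he hT hT' a b w
    exact ⟨φ.hom₃, φ.comm₂, φ.comm₃⟩

/-! ### The octahedral axiom -/

lemma isTriangulated (hS : IsFrobenius S) (he : IsNaturalSuspension e) :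
    letI := pretriangulated hS he
    IsTriangulated (StableCategory S) := by
  let _ := pretriangulated hS he
  refine IsTriangulated.mk' ?_
  intro X Y Z φ ψ
  obtain ⟨X, rfl⟩ : ∃ X', (toStable S).obj X' = X := ⟨X.as, rfl⟩
  obtain ⟨Y, rfl⟩ : ∃ Y', (toStable S).obj Y' = Y := ⟨Y.as, rfl⟩
  obtain ⟨Z, rfl⟩ : ∃ Z', (toStable S).obj Z' = Z := ⟨Z.as, rfl⟩
  obtain ⟨f₀, rfl⟩ := (toStable S).map_surjective φ
  obtain ⟨g₀, rfl⟩ := (toStable S).map_surjective ψ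
  -- The octahedron may be checked on an isomorphic composable pair, so both morphisms are replaced
  -- by inflations, the second one starting at the new `Y₁`.
  obtain ⟨Y₁, f, p, Z₁₂, v, w, hE₁₂, rfl, hp⟩ := hS.exists_inflation f₀
  obtain ⟨Z₁, g, q, Z₂₃, u, w', hE₂₃, hq, hq'⟩ := hS.exists_inflation (p ≫ g₀)
  obtain ⟨Z₁₃, r, m, m', w₁, w₂, hE₁₃, hE, hm, hm'⟩ := hS.exists_comp hE₁₂ hE₂₃
  obtain ⟨h₁₂, hh₁₂⟩ := exists_isInducedBy (e := e) hS hE₁₂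
  obtain ⟨h₂₃, hh₂₃⟩ := exists_isInducedBy (e := e) hS hE₂₃
  obtain ⟨h₁₃, hh₁₃⟩ := exists_isInducedBy (e := e) hS hE₁₃
  obtain ⟨h, hh⟩ := exists_isInducedBy (e := e) hS hE
  -- The octahedron's squares with connecting morphisms are naturality for three morphisms of
  -- sequences; `n₃` also identifies the connecting morphism of `Z₁₂ ⟶ Z₁₃ ⟶ Z₂₃`.
  have n₁ := IsInducedBy.naturality hS he hE₁₂ hh₁₂ hh₁₃
    { τ₁ := 𝟙 X, τ₂ := g, τ₃ := m, comm₁₂ := by simp, comm₂₃ := hm.symm }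
  have n₂ := IsInducedBy.naturality hS he hE₁₃ hh₁₃ hh₂₃
    { τ₁ := f, τ₂ := 𝟙 Z₁, τ₃ := m', comm₁₂ := by simp, comm₂₃ := by simp [hm'] }
  have n₃ := IsInducedBy.naturality hS he hE₂₃ hh₂₃ hh
    { τ₁ := v, τ₂ := r, τ₃ := 𝟙 Z₂₃, comm₁₂ := hm, comm₂₃ := by simp [hm'] }
  dsimp at n₁ n₂ n₃
  simp only [CategoryTheory.Functor.map_id, Category.comp_id, Category.id_comp] at n₁ n₃
  refine ⟨_, _, _, _, _, _, (toStable S).map f, (toStable S).map g, Iso.refl _,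
    (asIso ((toStable S).map p)).symm, (asIso ((toStable S).map q)).symm, ?_, ?_,
    (toStable S).map v, h₁₂, stableTriangle_mem hE₁₂ hh₁₂,
    (toStable S).map u, h₂₃, stableTriangle_mem hE₂₃ hh₂₃,
    (toStable S).map r, h₁₃, ?_, ⟨?_⟩⟩
  · simp
  · change (toStable S).map g₀ ≫ inv ((toStable S).map q) =
      inv ((toStable S).map p) ≫ (toStable S).map g
    rw [IsIso.comp_inv_eq, Category.assoc, IsIso.eq_inv_comp, ← Functor.map_comp,
      ← Functor.map_comp, hq]
  · rw [← Functor.map_comp]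
    exact stableTriangle_mem hE₁₃ hh₁₃
  · exact
      { m₁ := (toStable S).map m
        m₃ := (toStable S).map m'
        comm₁ := by rw [← Functor.map_comp, ← Functor.map_comp, hm]
        comm₂ := n₁.symm
        comm₃ := by rw [← Functor.map_comp, hm']
        comm₄ := n₂
        mem := by
          rw [n₃]
          exact stableTriangle_mem hE hh }

end RelativeExact

/-! ### Levelwise split short exact sequences of `N`-complexes -/

namespace NComplex

attribute [local instance] CategoryStruct.toQuiver hasBinaryBiproducts_of_finite_biproducts

variable {A : Type u} [Category.{v} A] [Preadditive A] {N : ℕ}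

section

variable {X Y Z : NComplex A N}

@[simp]
lemma zero_app (i : ℤ) : (0 : X ⟶ Y).hom.app i = 0 := rfl

@[simp]
lemma sub_app (f g : X ⟶ Y) (i : ℤ) : (f - g).hom.app i = f.hom.app i - g.hom.app i := rfl

lemma hom_ext {f g : X ⟶ Y} (h : ∀ i, f.hom.app i = g.hom.app i) : f = g := by
  ext i
  exact h i

lemma comp_app_eq {f : X ⟶ Y} {g : Y ⟶ Z} {h : X ⟶ Z} (w : f ≫ g = h) (i : ℤ) :
    f.hom.app i ≫ g.hom.app i = h.hom.app i := by
  rw [← w]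
  simp

lemma map_map (X : NComplex A N) {i j k : ℤ} (h : i ⟶ j) (h' : j ⟶ k) (h'' : i ⟶ k) :
    X.obj.map h ≫ X.obj.map h' = X.obj.map h'' := by
  rw [← X.obj.map_comp]
  rfl

lemma map_self (X : NComplex A N) {i : ℤ} (h : i ⟶ i) : X.obj.map h = 𝟙 _ :=
  X.obj.map_id i

lemma map_eq_zero (X : NComplex A N) {i j : ℤ} (h : i ⟶ j) (hij : i + N ≤ j) :
    X.obj.map h = 0 := by
  rw [← X.map_map (homOfLE (by lia : i ≤ i + N)) (homOfLE hij) h, X.property i, zero_comp]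

/-- Here `d ^ 0 = 𝟙` vanishes. This case is separate because strips of length `0` have no top or
bottom degree. -/
lemma isZero_of_eq_zero (hN : N = 0) (X : NComplex A N) : IsZero X := by
  rw [IsZero.iff_id_eq_zero]
  refine hom_ext fun i => ?_
  subst hN
  change 𝟙 (X.obj.obj i) = 0
  rw [← X.map_self (𝟙 i), X.map_eq_zero _ (by simp)]

/-- A morphism of `N`-complexes given by its components. -/
abbrev homMk (f : ∀ i, X.obj.obj i ⟶ Y.obj.obj i)
    (h : ∀ (i j : ℤ) (h : i ⟶ j), X.obj.map h ≫ f j = f i ≫ Y.obj.map h) : X ⟶ Y :=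
  ObjectProperty.homMk { app := f, naturality := h }

end

/-- Morphisms `r` and `s` in `A` splitting the short sequence given by `f` and `g`. -/
structure IsSplitBy {X Y Z : A} (f : X ⟶ Y) (g : Y ⟶ Z) (r : Y ⟶ X) (s : Z ⟶ Y) : Prop where
  f_r : f ≫ r = 𝟙 X
  s_g : s ≫ g = 𝟙 Z
  total : r ≫ f + g ≫ s = 𝟙 Y

namespace IsSplitBy

variable {X Y Z : A} {f : X ⟶ Y} {g : Y ⟶ Z} {r : Y ⟶ X} {s : Z ⟶ Y} (h : IsSplitBy f g r s)

include h

lemma g_s : g ≫ s = 𝟙 Y - r ≫ f := by rw [← h.total, add_sub_cancel_left]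

lemma r_f : r ≫ f = 𝟙 Y - g ≫ s := by rw [← h.total, add_sub_cancel_right]

lemma zero : f ≫ g = 0 := by
  have : r ≫ f ≫ g = 0 := by
    rw [reassoc_of% h.r_f, Preadditive.sub_comp, Category.id_comp, Category.assoc, h.s_g,
      Category.comp_id, sub_self]
  rw [← Category.id_comp (f ≫ g), ← h.f_r, Category.assoc, this, comp_zero]

lemma s_r : s ≫ r = 0 := by
  have : g ≫ s ≫ r = 0 := by
    rw [reassoc_of% h.g_s, Preadditive.sub_comp, Category.id_comp, Category.assoc, h.f_r,
      Category.comp_id, sub_self]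
  rw [← Category.id_comp (s ≫ r), ← h.s_g, Category.assoc, this, comp_zero]

lemma epi : Epi g := ⟨fun a b w => by simpa [reassoc_of% h.s_g] using s ≫= w⟩

lemma mono : Mono f := ⟨fun a b w => by simpa [h.f_r] using w =≫ r⟩

end IsSplitBy

lemma levelwiseSplit_mk {X Y Z : NComplex A N} {f : X ⟶ Y} {g : Y ⟶ Z} (w : f ≫ g = 0)
    {r : ∀ i, Y.obj.obj i ⟶ X.obj.obj i} {s : ∀ i, Z.obj.obj i ⟶ Y.obj.obj i}
    (h : ∀ i, IsSplitBy (f.hom.app i) (g.hom.app i) (r i) (s i)) :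
    levelwiseSplit A N (ShortComplex.mk f g w) := fun i =>
  ⟨{ r := r i, s := s i, f_r := (h i).f_r, s_g := (h i).s_g, id := (h i).total }⟩

lemma levelwiseSplit_of_eq_zero (hN : N = 0) (E : ShortComplex (NComplex A N)) :
    levelwiseSplit A N E := by
  have h0 (X : NComplex A N) (i : ℤ) : IsZero (X.obj.obj i) :=
    (NComplex.level A N i).map_isZero (isZero_of_eq_zero hN X)
  exact levelwiseSplit_mk (r := fun i => 0) (s := fun i => 0) _ fun i =>
    ⟨(h0 _ i).eq_of_src _ _, (h0 _ i).eq_of_src _ _, (h0 _ i).eq_of_src _ _⟩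

lemma exists_isSplitBy {E : ShortComplex (NComplex A N)} (hE : levelwiseSplit A N E) :
    ∃ (r : ∀ i, E.X₂.obj.obj i ⟶ E.X₁.obj.obj i) (s : ∀ i, E.X₃.obj.obj i ⟶ E.X₂.obj.obj i),
      ∀ i, IsSplitBy (E.f.hom.app i) (E.g.hom.app i) (r i) (s i) :=
  ⟨fun i => (hE i).some.r, fun i => (hE i).some.s,
    fun i => ⟨(hE i).some.f_r, (hE i).some.s_g, (hE i).some.id⟩⟩

/-- Complements chosen degree by degree inherit the differential `s ≫ d ≫ g`. Since `f` is a
morphism of complexes, `g` kills the error made by projecting (`key`), whence functoriality. -/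
lemma exists_cokernel {X Y : NComplex A N} (f : X ⟶ Y) (Q : ℤ → A) (g : ∀ i, Y.obj.obj i ⟶ Q i)
    (r : ∀ i, Y.obj.obj i ⟶ X.obj.obj i) (s : ∀ i, Q i ⟶ Y.obj.obj i)
    (h : ∀ i, IsSplitBy (f.hom.app i) (g i) (r i) (s i)) :
    ∃ (Z : NComplex A N) (p : Y ⟶ Z) (w : f ≫ p = 0),
      levelwiseSplit A N (ShortComplex.mk f p w) := by
  have key {i j : ℤ} (a : i ⟶ j) : g i ≫ s i ≫ Y.obj.map a ≫ g j = Y.obj.map a ≫ g j := by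
    rw [reassoc_of% (h i).g_s, Preadditive.sub_comp, Category.id_comp, Category.assoc,
      ← NatTrans.naturality_assoc, (h j).zero]
    simp
  let Z : NComplex A N :=
    { obj :=
        { obj := Q
          map := fun {i j} a => s i ≫ Y.obj.map a ≫ g j
          map_id := fun i => by
            rw [CategoryTheory.Functor.map_id, Category.id_comp, (h i).s_g]
          map_comp := fun a b => by
            rw [Category.assoc, Category.assoc, key, Y.obj.map_comp, Category.assoc] }
      property := fun i => by
        change s i ≫ Y.obj.map _ ≫ g _ = 0
        rw [Y.property i, zero_comp, comp_zero] }
  let p : Y ⟶ Z := homMk g (fun i j a => (key a).symm)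
  have w : f ≫ p = 0 := hom_ext fun i => (h i).zero
  exact ⟨Z, p, w, levelwiseSplit_mk w h⟩

lemma exists_kernel {Y Z : NComplex A N} (g : Y ⟶ Z) (P : ℤ → A) (f : ∀ i, P i ⟶ Y.obj.obj i)
    (r : ∀ i, Y.obj.obj i ⟶ P i) (s : ∀ i, Z.obj.obj i ⟶ Y.obj.obj i)
    (h : ∀ i, IsSplitBy (f i) (g.hom.app i) (r i) (s i)) :
    ∃ (X : NComplex A N) (p : X ⟶ Y) (w : p ≫ g = 0),
      levelwiseSplit A N (ShortComplex.mk p g w) := by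
  have key {i j : ℤ} (a : i ⟶ j) : f i ≫ Y.obj.map a ≫ r j ≫ f j = f i ≫ Y.obj.map a := by
    rw [(h j).r_f, Preadditive.comp_sub, Category.comp_id, NatTrans.naturality_assoc,
      Preadditive.comp_sub, reassoc_of% (h i).zero]
    simp
  let X : NComplex A N :=
    { obj :=
        { obj := P
          map := fun {i j} a => f i ≫ Y.obj.map a ≫ r j
          map_id := fun i => by
            rw [CategoryTheory.Functor.map_id, Category.id_comp, (h i).f_r]
          map_comp := fun {i j k} a b => by
            have := key a =≫ (Y.obj.map b ≫ r k)
            simp only [Category.assoc] at this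
            rw [Category.assoc, Category.assoc, this, Y.obj.map_comp, Category.assoc] }
      property := fun i => by
        change f i ≫ Y.obj.map _ ≫ r _ = 0
        rw [Y.property i, zero_comp, comp_zero] }
  let p : X ⟶ Y := homMk f (fun i j a => by
    change (f i ≫ Y.obj.map a ≫ r j) ≫ f j = _
    rw [Category.assoc, Category.assoc, key])
  have w : p ≫ g = 0 := hom_ext fun i => (h i).zero
  exact ⟨X, p, w, levelwiseSplit_mk w h⟩

lemma exists_desc {E : ShortComplex (NComplex A N)} (hE : levelwiseSplit A N E)
    {W : NComplex A N} (a : E.X₂ ⟶ W) (w : E.f ≫ a = 0) : ∃ b : E.X₃ ⟶ W, E.g ≫ b = a := by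
  obtain ⟨r, s, h⟩ := exists_isSplitBy hE
  have key (i : ℤ) : E.g.hom.app i ≫ s i ≫ a.hom.app i = a.hom.app i := by
    rw [reassoc_of% (h i).g_s, Preadditive.sub_comp, Category.id_comp, Category.assoc,
      comp_app_eq w]
    simp
  refine ⟨homMk (fun i => s i ≫ a.hom.app i) fun i j b => ?_, hom_ext key⟩
  have := (h i).epi
  rw [← cancel_epi (E.g.hom.app i), ← NatTrans.naturality_assoc, key, Category.assoc,
    reassoc_of% (key i), a.hom.naturality]

lemma exists_lift {E : ShortComplex (NComplex A N)} (hE : levelwiseSplit A N E)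
    {W : NComplex A N} (a : W ⟶ E.X₂) (w : a ≫ E.g = 0) : ∃ b : W ⟶ E.X₁, b ≫ E.f = a := by
  obtain ⟨r, s, h⟩ := exists_isSplitBy hE
  have key (i : ℤ) : (a.hom.app i ≫ r i) ≫ E.f.hom.app i = a.hom.app i := by
    rw [Category.assoc, (h i).r_f, Preadditive.comp_sub, Category.comp_id,
      reassoc_of% (comp_app_eq w i)]
    simp
  refine ⟨homMk (fun i => a.hom.app i ≫ r i) fun i j b => ?_, hom_ext key⟩
  have := (h j).mono
  rw [← cancel_mono (E.f.hom.app j), Category.assoc, key, Category.assoc, E.f.hom.naturality,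
    ← Category.assoc, key, a.hom.naturality]

lemma mono_f {E : ShortComplex (NComplex A N)} (hE : levelwiseSplit A N E) : Mono E.f := by
  obtain ⟨r, s, h⟩ := exists_isSplitBy hE
  refine ⟨fun a b w => hom_ext fun i => ?_⟩
  have := (h i).mono
  rw [← cancel_mono (E.f.hom.app i), comp_app_eq w, comp_app_eq rfl]

lemma epi_g {E : ShortComplex (NComplex A N)} (hE : levelwiseSplit A N E) : Epi E.g := by
  obtain ⟨r, s, h⟩ := exists_isSplitBy hE
  refine ⟨fun a b w => hom_ext fun i => ?_⟩
  have := (h i).epi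
  rw [← cancel_epi (E.g.hom.app i), comp_app_eq w, comp_app_eq rfl]

lemma levelwiseSplit_of_isZero (X : NComplex A N) {Z : NComplex A N} (hZ : IsZero Z) :
    levelwiseSplit A N (ShortComplex.mk (𝟙 X) (0 : X ⟶ Z) (by simp)) :=
  levelwiseSplit_mk (r := fun i => 𝟙 _) (s := fun i => 0) _ fun i =>
    { f_r := by simp
      s_g := ((NComplex.level A N i).map_isZero hZ).eq_of_src _ _
      total := by simp }

/-- If `f ≫ g` is split with complement `q`, then the complement of `f` splits off that of
`f ≫ g`, the complement being that of `g`. -/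
lemma IsSplitBy.of_comp {X Y Z Z' X' Y' : A} {f : X ⟶ Y} {v : Y ⟶ Z'} {r : Y ⟶ X} {s : Z' ⟶ Y}
    {g : Y ⟶ Z} {u : Z ⟶ X'} {r' : Z ⟶ Y} {s' : X' ⟶ Z} (h : IsSplitBy f v r s)
    (h' : IsSplitBy g u r' s') {q : Z ⟶ Y'} {r'' : Z ⟶ X} {s'' : Y' ⟶ Z}
    (h'' : IsSplitBy (f ≫ g) q r'' s'') {m : Z' ⟶ Y'} {m' : Y' ⟶ X'} (hm : v ≫ m = g ≫ q)
    (hm' : q ≫ m' = u) : IsSplitBy m m' (s'' ≫ r' ≫ v) (s' ≫ q) := by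
  have hq : q ≫ s'' ≫ r' ≫ v = r' ≫ v := by
    rw [reassoc_of% h''.g_s]
    simp [reassoc_of% h'.f_r, h.zero]
  refine ⟨?_, ?_, ?_⟩
  · have := h.epi
    rw [← cancel_epi v, reassoc_of% hm, hq, reassoc_of% h'.f_r, Category.comp_id]
  · rw [Category.assoc, hm', h'.s_g]
  · have := h''.epi
    rw [← cancel_epi q, Preadditive.comp_add, Category.comp_id, reassoc_of% hm', Category.assoc,
      Category.assoc, reassoc_of% hq, hm, reassoc_of% h'.g_s]
    simp

/-- Morphisms in `A` exhibiting `B` as a biproduct of `X` and `Y`. -/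
structure IsBiprodBy {X Y B : A} (p : B ⟶ X) (q : B ⟶ Y) (i : X ⟶ B) (j : Y ⟶ B) : Prop where
  i_p : i ≫ p = 𝟙 X
  i_q : i ≫ q = 0
  j_p : j ≫ p = 0
  j_q : j ≫ q = 𝟙 Y
  total : p ≫ i + q ≫ j = 𝟙 B

lemma IsBiprodBy.hom_ext {X Y B T : A} {p : B ⟶ X} {q : B ⟶ Y} {i : X ⟶ B} {j : Y ⟶ B}
    (h : IsBiprodBy p q i j) {a b : T ⟶ B} (hp : a ≫ p = b ≫ p) (hq : a ≫ q = b ≫ q) :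
    a = b := by
  rw [← Category.comp_id a, ← Category.comp_id b, ← h.total, Preadditive.comp_add,
    Preadditive.comp_add, reassoc_of% hp, reassoc_of% hq]

/-- The retraction lifts the `Z`-coordinate by `s` and then corrects by the element of `X` that `r'`
extracts from the remaining discrepancy in `Y'`. The section has a sign because `d` is `-g'` on
`Y'`. -/
lemma IsSplitBy.biprod_lift_desc {X Y Z Y' Z' B : A} {f : X ⟶ Y} {g : Y ⟶ Z} {r : Y ⟶ X}
    {s : Z ⟶ Y} {f' : X ⟶ Y'} {g' : Y' ⟶ Z'} {r' : Y' ⟶ X} {s' : Z' ⟶ Y'}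
    (h : IsSplitBy f g r s) (h' : IsSplitBy f' g' r' s') {p : B ⟶ Z} {q : B ⟶ Y'} {i : Z ⟶ B}
    {j : Y' ⟶ B} (hB : IsBiprodBy p q i j) {b : Y ⟶ Y'} {c : Z ⟶ Z'} (hb : f ≫ b = f')
    (hc : g ≫ c = b ≫ g') {l : Y ⟶ B} {d : B ⟶ Z'} (lp : l ≫ p = g) (lq : l ≫ q = b)
    (di : i ≫ d = c) (dj : j ≫ d = -g') :
    IsSplitBy l d (p ≫ s + (q - p ≫ s ≫ b) ≫ r' ≫ f) (-(s' ≫ j)) := by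
  have hs : s ≫ b ≫ g' = c := by rw [← hc, reassoc_of% h.s_g]
  have hd : d = p ≫ c - q ≫ g' := by
    rw [← Category.id_comp d, ← hB.total, Preadditive.add_comp, Category.assoc, Category.assoc,
      di, dj, Preadditive.comp_neg, sub_eq_add_neg]
  refine ⟨?_, ?_, ?_⟩
  · have : g ≫ s ≫ b = b - r ≫ f' := by
      rw [reassoc_of% h.g_s, Preadditive.sub_comp, Category.id_comp, Category.assoc, hb]
    simp only [Preadditive.comp_add, Preadditive.sub_comp, Preadditive.comp_sub, reassoc_of% lp,
      reassoc_of% lq, Category.assoc]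
    rw [reassoc_of% this, Preadditive.sub_comp, Category.assoc, reassoc_of% h'.f_r, h.g_s]
    abel
  · rw [Preadditive.neg_comp, Category.assoc, dj, Preadditive.comp_neg, neg_neg, h'.s_g]
  · apply hB.hom_ext
    · simp [lp, hB.j_p, h.s_g, h.zero]
    · simp only [Preadditive.add_comp, Preadditive.sub_comp, Preadditive.comp_sub,
        Preadditive.neg_comp, Preadditive.comp_neg, Category.assoc, Category.comp_id,
        Category.id_comp, lq, hB.j_q, hb, h'.r_f, hd, reassoc_of% hs]
      abel

variable [HasFiniteBiproducts A]

/-- Lets splitting lemmas in `A` be applied to the terms of a biproduct of complexes, without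
comparing them with chosen biproducts in `A`. -/
lemma isBiprodBy_app (X Y : NComplex A N) (n : ℤ) :
    IsBiprodBy ((biprod.fst (X := X) (Y := Y)).hom.app n) ((biprod.snd (X := X) (Y := Y)).hom.app n)
      ((biprod.inl (X := X) (Y := Y)).hom.app n) ((biprod.inr (X := X) (Y := Y)).hom.app n) where
  i_p := comp_app_eq biprod.inl_fst n
  i_q := comp_app_eq biprod.inl_snd n
  j_p := comp_app_eq biprod.inr_fst n
  j_q := comp_app_eq biprod.inr_snd n
  total := congrArg (fun t => t.hom.app n) (biprod.total (X := X) (Y := Y))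

/-- A shear of `W ⊞ Y` by `r ≫ a` turns `(a, f)` into `(0, f)`, so the complement is `W ⊞ Z`. -/
lemma IsSplitBy.biprod_lift {X Y Z W B : A} {f : X ⟶ Y} {g : Y ⟶ Z} {r : Y ⟶ X} {s : Z ⟶ Y}
    (h : IsSplitBy f g r s) {p : B ⟶ W} {q : B ⟶ Y} {i : W ⟶ B} {j : Y ⟶ B}
    (hB : IsBiprodBy p q i j) {a : X ⟶ W} {l : X ⟶ B} (hp : l ≫ p = a) (hq : l ≫ q = f) :
    IsSplitBy l (biprod.lift (p - q ≫ r ≫ a) (q ≫ g)) (q ≫ r) (biprod.desc i (s ≫ j)) := by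
  refine ⟨?_, ?_, ?_⟩
  · rw [reassoc_of% hq, h.f_r]
  · ext
    · simp [hB.i_p, reassoc_of% hB.i_q]
    · simp [reassoc_of% hB.i_q]
    · simp [hB.j_p, reassoc_of% hB.j_q, reassoc_of% h.s_r]
    · simp [reassoc_of% hB.j_q, h.s_g]
  · apply hB.hom_ext
    · simp [hp, hB.i_p, hB.j_p]
    · simp [hq, hB.i_q, hB.j_q, h.g_s]

lemma exists_biprod_lift {E : ShortComplex (NComplex A N)} (hE : levelwiseSplit A N E)
    {W : NComplex A N} (a : E.X₁ ⟶ W) :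
    ∃ (Q : NComplex A N) (q : W ⊞ E.X₂ ⟶ Q) (w : biprod.lift a E.f ≫ q = 0),
      levelwiseSplit A N (ShortComplex.mk _ q w) := by
  obtain ⟨r, s, h⟩ := exists_isSplitBy hE
  exact exists_cokernel _ _ _ _ _ fun n => (h n).biprod_lift (isBiprodBy_app W E.X₂ n)
    (comp_app_eq (biprod.lift_fst a E.f) n) (comp_app_eq (biprod.lift_snd a E.f) n)

lemma levelwiseSplit_biprod_lift_desc {X Y Z Y' Z' : NComplex A N} {f : X ⟶ Y} {g : Y ⟶ Z}
    {f' : X ⟶ Y'} {g' : Y' ⟶ Z'} {w : f ≫ g = 0} {w' : f' ≫ g' = 0}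
    (hE : levelwiseSplit A N (ShortComplex.mk f g w))
    (hE' : levelwiseSplit A N (ShortComplex.mk f' g' w')) (j : Y ⟶ Y') (k : Z ⟶ Z')
    (hj : f ≫ j = f') (hk : g ≫ k = j ≫ g') :
    levelwiseSplit A N
      (ShortComplex.mk (biprod.lift g j) (biprod.desc k (-g')) (by simp [hk])) := by
  obtain ⟨r, s, h⟩ := exists_isSplitBy hE
  obtain ⟨r', s', h'⟩ := exists_isSplitBy hE'
  exact levelwiseSplit_mk _ fun n => (h n).biprod_lift_desc (h' n) (isBiprodBy_app Z Y' n)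
    (comp_app_eq hj n) (comp_app_eq hk n) (comp_app_eq (biprod.lift_fst g j) n)
    (comp_app_eq (biprod.lift_snd g j) n) (comp_app_eq (biprod.inl_desc k (-g')) n)
    (comp_app_eq (biprod.inr_desc k (-g')) n)

/-- The composition of two split monomorphisms with complements is one. -/
lemma IsSplitBy.comp {X Y Z Z' X' : A} {f : X ⟶ Y} {v : Y ⟶ Z'} {r : Y ⟶ X} {s : Z' ⟶ Y}
    {g : Y ⟶ Z} {u : Z ⟶ X'} {r' : Z ⟶ Y} {s' : X' ⟶ Z} (h : IsSplitBy f v r s)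
    (h' : IsSplitBy g u r' s') :
    IsSplitBy (f ≫ g) (biprod.lift (r' ≫ v) u) (r' ≫ r) (biprod.desc (s ≫ g) s') := by
  refine ⟨?_, ?_, ?_⟩
  · rw [Category.assoc, reassoc_of% h'.f_r, h.f_r]
  · ext
    · simp [reassoc_of% h'.f_r, h.s_g]
    · simp [h'.zero]
    · simp [reassoc_of% h'.s_r]
    · simp [h'.s_g]
  · rw [biprod.lift_desc, Category.assoc, Category.assoc, reassoc_of% h.r_f,
      reassoc_of% h.g_s, h'.g_s]
    simp only [Preadditive.sub_comp, Preadditive.comp_sub, Category.id_comp, Category.assoc]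
    rw [reassoc_of% h.g_s, Preadditive.sub_comp, Preadditive.comp_sub, Category.id_comp,
      Category.assoc]
    abel

lemma exists_comp {X Y Z Z' X' : NComplex A N} {f : X ⟶ Y} {v : Y ⟶ Z'} {g : Y ⟶ Z} {u : Z ⟶ X'}
    {w : f ≫ v = 0} {w' : g ≫ u = 0} (hf : levelwiseSplit A N (ShortComplex.mk f v w))
    (hg : levelwiseSplit A N (ShortComplex.mk g u w')) :
    ∃ (Y' : NComplex A N) (q : Z ⟶ Y') (m : Z' ⟶ Y') (m' : Y' ⟶ X') (w₁ : (f ≫ g) ≫ q = 0)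
      (w₂ : m ≫ m' = 0), levelwiseSplit A N (ShortComplex.mk (f ≫ g) q w₁) ∧
        levelwiseSplit A N (ShortComplex.mk m m' w₂) ∧ v ≫ m = g ≫ q ∧ q ≫ m' = u := by
  obtain ⟨r, s, h⟩ := exists_isSplitBy hf
  obtain ⟨r', s', h'⟩ := exists_isSplitBy hg
  dsimp at r s h r' s' h'
  obtain ⟨Y', q, wq, hq⟩ := exists_cokernel (f ≫ g) _ _ _ _ fun i => (h i).comp (h' i)
  obtain ⟨r'', s'', h''⟩ := exists_isSplitBy hq
  obtain ⟨m, hm⟩ := exists_desc hf (g ≫ q) (by simpa using wq)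
  obtain ⟨m', hm'⟩ := exists_desc hq u (by simp [w'])
  dsimp at m hm m' hm'
  have := epi_g hf
  dsimp at this
  have w₂ : m ≫ m' = 0 := by rw [← cancel_epi v, reassoc_of% hm, hm', w', comp_zero]
  exact ⟨Y', q, m, m', wq, w₂, hq, levelwiseSplit_mk w₂ fun i => (h i).of_comp (h' i) (h'' i)
    ((comp_app_eq hm i).trans (comp_app_eq rfl i).symm) (comp_app_eq hm' i), hm, hm'⟩

end NComplex

/-! ### Injective-projective `N`-complexes -/

namespace NComplex

attribute [local instance] CategoryStruct.toQuiver hasBinaryBiproducts_of_finite_biproducts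

variable {A : Type u} [Category.{v} A] [Preadditive A] {N : ℕ} [HasFiniteBiproducts A]

section

-- Arbitrary bounds serve both strips ending at `l` (hulls) and strips starting at `l` (cohulls).
-- Finiteness makes each degree a finite biproduct.
variable {b u : ℤ → ℤ} (hbu : ∀ l, u l + 1 = b l + N)
  [∀ n, Finite {l : ℤ // b l ≤ n ∧ n ≤ u l}] (M : ℤ → A)

/-- The direct sum of the `N`-complexes `M l ⟶ M l ⟶ ⋯ ⟶ M l` whose differentials are identities
and which are concentrated in the degrees from `b l` to `u l`. -/
def strip : NComplex A N where
  obj :=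
    { obj := fun n => ⨁ fun l : {l : ℤ // b l ≤ n ∧ n ≤ u l} => M l
      map := fun {n m} h => biproduct.lift fun l =>
        if hl : b l ≤ n then biproduct.π (fun l : {l : ℤ // b l ≤ n ∧ n ≤ u l} => M l)
          ⟨l, hl, (leOfHom h).trans l.2.2⟩ else 0
      map_id := fun n => by
        refine biproduct.hom_ext _ _ fun l => ?_
        rw [biproduct.lift_π, dif_pos l.2.1, Category.id_comp]
      map_comp := fun {n m p} h h' => by
        refine biproduct.hom_ext _ _ fun l => ?_
        rw [biproduct.lift_π, Category.assoc, biproduct.lift_π]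
        by_cases hn : b l ≤ n
        · rw [dif_pos hn, dif_pos (hn.trans (leOfHom h)), biproduct.lift_π, dif_pos hn]
        · rw [dif_neg hn]
          by_cases hm : b l ≤ m
          · rw [dif_pos hm, biproduct.lift_π, dif_neg hn]
          · rw [dif_neg hm, comp_zero] }
  -- A summand lives in only `N` consecutive degrees, hence never in both `n` and `n + N`.
  property n := by
    refine biproduct.hom_ext _ _ fun l => ?_
    rw [biproduct.lift_π, zero_comp, dif_neg]
    have := l.2.2
    have := hbu l
    lia

/-- The projection from `strip` to a summand. -/
def stripπ (n : ℤ) (l : {l : ℤ // b l ≤ n ∧ n ≤ u l}) :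
    (strip hbu M).obj.obj n ⟶ M l :=
  biproduct.π (fun l : {l : ℤ // b l ≤ n ∧ n ≤ u l} => M l) l

/-- The inclusion in `strip` of a summand. -/
def stripι (n : ℤ) (l : {l : ℤ // b l ≤ n ∧ n ≤ u l}) :
    M l ⟶ (strip hbu M).obj.obj n :=
  biproduct.ι (fun l : {l : ℤ // b l ≤ n ∧ n ≤ u l} => M l) l

variable {hbu M}

lemma strip_hom_ext {n : ℤ} {T : A} {f g : T ⟶ (strip hbu M).obj.obj n}
    (h : ∀ l, f ≫ stripπ hbu M n l = g ≫ stripπ hbu M n l) : f = g :=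
  biproduct.hom_ext _ _ h

lemma strip_hom_ext' {n : ℤ} {T : A} {f g : (strip hbu M).obj.obj n ⟶ T}
    (h : ∀ l, stripι hbu M n l ≫ f = stripι hbu M n l ≫ g) : f = g :=
  biproduct.hom_ext' _ _ h

lemma map_stripπ {n m : ℤ} (h : n ⟶ m) (l : {l : ℤ // b l ≤ m ∧ m ≤ u l}) (hl : b l ≤ n) :
    (strip hbu M).obj.map h ≫ stripπ hbu M m l =
      stripπ hbu M n ⟨l, hl, (leOfHom h).trans l.2.2⟩ :=
  (biproduct.lift_π _ _).trans (dif_pos hl)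

lemma map_stripπ_eq_zero {n m : ℤ} (h : n ⟶ m) (l : {l : ℤ // b l ≤ m ∧ m ≤ u l})
    (hl : ¬ b l ≤ n) : (strip hbu M).obj.map h ≫ stripπ hbu M m l = 0 :=
  (biproduct.lift_π _ _).trans (dif_neg hl)

lemma stripι_π_self (n : ℤ) (l : {l : ℤ // b l ≤ n ∧ n ≤ u l}) :
    stripι hbu M n l ≫ stripπ hbu M n l = 𝟙 _ :=
  biproduct.ι_π_self _ _

lemma stripι_π_ne {n : ℤ} {l l' : {l : ℤ // b l ≤ n ∧ n ≤ u l}} (h : l ≠ l') :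
    stripι hbu M n l ≫ stripπ hbu M n l' = 0 :=
  biproduct.ι_π_ne _ h

lemma stripι_map {n m : ℤ} (h : n ⟶ m) (l : {l : ℤ // b l ≤ n ∧ n ≤ u l}) (hl : m ≤ u l) :
    stripι hbu M n l ≫ (strip hbu M).obj.map h =
      stripι hbu M m ⟨l, l.2.1.trans (leOfHom h), hl⟩ := by
  refine strip_hom_ext fun l' => ?_
  rw [Category.assoc]
  by_cases hll : l.1 = l'.1
  · obtain ⟨l, h₁, h₂⟩ := l
    obtain ⟨l', h₁', h₂'⟩ := l'
    obtain rfl : l = l' := hll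
    rw [map_stripπ h _ h₁, stripι_π_self, stripι_π_self]
  · rw [stripι_π_ne (fun h => hll (congrArg Subtype.val h))]
    by_cases hl' : b l' ≤ n
    · rw [map_stripπ h _ hl', stripι_π_ne (fun h => hll (congrArg Subtype.val h))]
    · rw [map_stripπ_eq_zero h _ hl', comp_zero]

lemma stripι_map_eq_zero {n m : ℤ} (h : n ⟶ m) (l : {l : ℤ // b l ≤ n ∧ n ≤ u l})
    (hl : ¬ m ≤ u l) : stripι hbu M n l ≫ (strip hbu M).obj.map h = 0 := by
  refine strip_hom_ext fun l' => ?_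
  rw [Category.assoc, zero_comp]
  by_cases hl' : b l' ≤ n
  · rw [map_stripπ h _ hl', stripι_π_ne]
    rintro rfl
    exact hl l'.2.2
  · rw [map_stripπ_eq_zero h _ hl', comp_zero]

/-- The morphism to a term of `strip` with given components. -/
def stripLift {T : A} (n : ℤ) (φ : ∀ l : {l : ℤ // b l ≤ n ∧ n ≤ u l}, T ⟶ M l) :
    T ⟶ (strip hbu M).obj.obj n :=
  biproduct.lift φ

lemma stripLift_π {T : A} {n : ℤ} (φ : ∀ l : {l : ℤ // b l ≤ n ∧ n ≤ u l}, T ⟶ M l)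
    (l : {l : ℤ // b l ≤ n ∧ n ≤ u l}) :
    stripLift (hbu := hbu) n φ ≫ stripπ hbu M n l = φ l :=
  biproduct.lift_π _ _

/-- The morphism from a term of `strip` with given components. -/
def stripDesc {T : A} (n : ℤ) (φ : ∀ l : {l : ℤ // b l ≤ n ∧ n ≤ u l}, M l ⟶ T) :
    (strip hbu M).obj.obj n ⟶ T :=
  biproduct.desc φ

lemma stripι_desc {T : A} {n : ℤ} (φ : ∀ l : {l : ℤ // b l ≤ n ∧ n ≤ u l}, M l ⟶ T)
    (l : {l : ℤ // b l ≤ n ∧ n ≤ u l}) :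
    stripι hbu M n l ≫ stripDesc (hbu := hbu) n φ = φ l :=
  biproduct.ι_desc _ _

/-- The morphism to `strip` given by its components in top degrees. -/
def toStrip {X : NComplex A N} (φ : ∀ l, X.obj.obj (u l) ⟶ M l) : X ⟶ strip hbu M :=
  homMk (fun n => stripLift n fun l => X.obj.map (homOfLE l.2.2) ≫ φ l) fun n m h => by
    refine strip_hom_ext fun l => ?_
    rw [Category.assoc, Category.assoc, stripLift_π,
      reassoc_of% X.map_map h (homOfLE l.2.2) (homOfLE ((leOfHom h).trans l.2.2))]
    by_cases hl : b l ≤ n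
    · rw [map_stripπ h _ hl, stripLift_π]
    -- Below degree `b l` there are at least `N` steps up to `u l`, so the component vanishes since
    -- `d ^ N = 0`.
    · rw [map_stripπ_eq_zero h _ hl, comp_zero, X.map_eq_zero, zero_comp]
      have := hbu l
      lia

lemma toStrip_π {X : NComplex A N} (φ : ∀ l, X.obj.obj (u l) ⟶ M l) (n : ℤ)
    (l : {l : ℤ // b l ≤ n ∧ n ≤ u l}) :
    (toStrip (hbu := hbu) φ).hom.app n ≫ stripπ hbu M n l = X.obj.map (homOfLE l.2.2) ≫ φ l :=
  stripLift_π _ _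

/-- The morphism from `strip` given by its components in bottom degrees. -/
def fromStrip {X : NComplex A N} (φ : ∀ l, M l ⟶ X.obj.obj (b l)) : strip hbu M ⟶ X :=
  homMk (fun n => stripDesc n fun l => φ l ≫ X.obj.map (homOfLE l.2.1)) fun n m h => by
    refine strip_hom_ext' fun l => ?_
    rw [reassoc_of% stripι_desc, Category.assoc, X.map_map _ h (homOfLE (l.2.1.trans (leOfHom h)))]
    by_cases hl : m ≤ u l
    · rw [← Category.assoc, stripι_map h _ hl, stripι_desc]
    · rw [← Category.assoc, stripι_map_eq_zero h _ hl, zero_comp, X.map_eq_zero, comp_zero]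
      have := hbu l
      lia

lemma stripι_fromStrip {X : NComplex A N} (φ : ∀ l, M l ⟶ X.obj.obj (b l)) (n : ℤ)
    (l : {l : ℤ // b l ≤ n ∧ n ≤ u l}) :
    stripι hbu M n l ≫ (fromStrip (hbu := hbu) φ).hom.app n =
      φ l ≫ X.obj.map (homOfLE l.2.1) :=
  stripι_desc _ _

/-- Extending into a strip is a problem in `A` at the top degree, solved by the retraction there;
lifting out of it is one at the bottom degree, solved by the section. Positivity of `N` ensures that
these degrees belong to the strip. -/
lemma isProjInj_strip (hN : 0 < N) : IsProjInj (levelwiseSplit A N) (strip hbu M) := by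
  have hle (l : ℤ) : b l ≤ u l := by
    have := hbu l
    lia
  refine ⟨fun E hE f => ?_, fun E hE f => ?_⟩
  · obtain ⟨r, s, h⟩ := exists_isSplitBy hE
    refine ⟨toStrip fun l => r (u l) ≫ f.hom.app (u l) ≫ stripπ hbu M (u l) ⟨l, hle l, le_rfl⟩,
      hom_ext fun n => strip_hom_ext fun l => ?_⟩
    rw [← comp_app_eq rfl, Category.assoc, toStrip_π, ← NatTrans.naturality_assoc,
      reassoc_of% (h (u l)).f_r, f.hom.naturality_assoc, 
      map_stripπ (homOfLE l.2.2) ⟨l, hle l, le_rfl⟩ l.2.1]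
  · obtain ⟨r, s, h⟩ := exists_isSplitBy hE
    refine ⟨fromStrip fun l =>
      stripι hbu M (b l) ⟨l, le_rfl, hle l⟩ ≫ f.hom.app (b l) ≫ s (b l),
      hom_ext fun n => strip_hom_ext' fun l => ?_⟩
    rw [← comp_app_eq rfl, ← Category.assoc, stripι_fromStrip, Category.assoc, Category.assoc,
      Category.assoc, E.g.hom.naturality, reassoc_of% (h (b l)).s_g, ← f.hom.naturality,
      ← Category.assoc, 
      stripι_map (homOfLE l.2.1) ⟨l, le_rfl, hle l⟩ l.2.2]

end

end NComplex

/-! ### Enough injective-projective `N`-complexes -/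

namespace NComplex

attribute [local instance] CategoryStruct.toQuiver hasBinaryBiproducts_of_finite_biproducts

variable {A : Type u} [Category.{v} A] [Preadditive A] {N : ℕ} [HasFiniteBiproducts A]

open scoped Classical in
lemma isSplitBy_biproduct_lift {J : Type} [Finite J] (M : J → A) (j₀ : J)
    (φ : ∀ j, M j₀ ⟶ M j) (hφ : φ j₀ = 𝟙 _) :
    IsSplitBy (biproduct.lift φ)
      (biproduct.lift fun j : {j // j ≠ j₀} => biproduct.π M j - biproduct.π M j₀ ≫ φ j)
      (biproduct.π M j₀) (biproduct.desc fun j : {j // j ≠ j₀} => biproduct.ι M j) where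
  f_r := by rw [biproduct.lift_π, hφ]
  s_g := by
    refine biproduct.hom_ext' _ _ fun j => biproduct.hom_ext _ _ fun j' => ?_
    rw [biproduct.ι_desc_assoc, Category.assoc, biproduct.lift_π, Category.comp_id,
      Preadditive.comp_sub, biproduct.ι_π_ne_assoc _ j.2, zero_comp, sub_zero]
    by_cases h : j = j'
    · subst h
      rw [biproduct.ι_π_self, biproduct.ι_π_self]
    · rw [biproduct.ι_π_ne _ h, biproduct.ι_π_ne _ (fun h' => h (Subtype.ext h'))]
  total := by
    have key (j : {j // j ≠ j₀}) : (biproduct.desc fun j : {j // j ≠ j₀} => biproduct.ι M j) ≫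
        biproduct.π M j = biproduct.π (fun j : {j // j ≠ j₀} => M j) j := by
      refine biproduct.hom_ext' _ _ fun j' => ?_
      rw [biproduct.ι_desc_assoc]
      by_cases h : j' = j
      · subst h
        rw [biproduct.ι_π_self, biproduct.ι_π_self]
      · rw [biproduct.ι_π_ne _ h, biproduct.ι_π_ne _ (fun h' => h (Subtype.ext h'))]
    have key₀ : (biproduct.desc fun j : {j // j ≠ j₀} => biproduct.ι M j) ≫
        biproduct.π M j₀ = 0 := by
      refine biproduct.hom_ext' _ _ fun j' => ?_
      rw [biproduct.ι_desc_assoc, biproduct.ι_π_ne _ j'.2, comp_zero]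
    refine biproduct.hom_ext _ _ fun j => ?_
    rw [Preadditive.add_comp, Category.assoc, Category.assoc, biproduct.lift_π, Category.id_comp]
    by_cases h : j = j₀
    · subst h
      rw [key₀, hφ, comp_zero, add_zero, Category.comp_id]
    · rw [key ⟨j, h⟩, biproduct.lift_π, add_sub_cancel]

open scoped Classical in
lemma isSplitBy_biproduct_desc {J : Type} [Finite J] (M : J → A) (j₀ : J)
    (φ : ∀ j, M j ⟶ M j₀) (hφ : φ j₀ = 𝟙 _) :
    IsSplitBy
      (biproduct.desc fun j : {j // j ≠ j₀} => biproduct.ι M j - φ j ≫ biproduct.ι M j₀)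
      (biproduct.desc φ) (biproduct.lift fun j : {j // j ≠ j₀} => biproduct.π M j)
      (biproduct.ι M j₀) where
  f_r := by
    refine biproduct.hom_ext' _ _ fun j => biproduct.hom_ext _ _ fun j' => ?_
    rw [biproduct.ι_desc_assoc, Category.assoc, biproduct.lift_π, Category.comp_id,
      Preadditive.sub_comp, Category.assoc, biproduct.ι_π_ne _ (Ne.symm j'.2), comp_zero, sub_zero]
    by_cases h : j = j'
    · subst h
      rw [biproduct.ι_π_self, biproduct.ι_π_self]
    · rw [biproduct.ι_π_ne _ h, biproduct.ι_π_ne _ (fun h' => h (Subtype.ext h'))]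
  s_g := by rw [biproduct.ι_desc, hφ]
  total := by
    have key (j : {j // j ≠ j₀}) :
        biproduct.ι M j ≫ (biproduct.lift fun j : {j // j ≠ j₀} => biproduct.π M j) =
          biproduct.ι (fun j : {j // j ≠ j₀} => M j) j := by
      refine biproduct.hom_ext _ _ fun j' => ?_
      rw [Category.assoc, biproduct.lift_π]
      by_cases h : j = j'
      · subst h
        rw [biproduct.ι_π_self, biproduct.ι_π_self]
      · rw [biproduct.ι_π_ne _ h, biproduct.ι_π_ne _ (fun h' => h (Subtype.ext h'))]
    have key₀ : biproduct.ι M j₀ ≫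
        (biproduct.lift fun j : {j // j ≠ j₀} => biproduct.π M j) = 0 := by
      refine biproduct.hom_ext _ _ fun j' => ?_
      rw [Category.assoc, biproduct.lift_π, biproduct.ι_π_ne _ (Ne.symm j'.2), zero_comp]
    refine biproduct.hom_ext' _ _ fun j => ?_
    rw [Preadditive.comp_add, biproduct.ι_desc_assoc, Category.comp_id]
    by_cases h : j = j₀
    · subst h
      rw [reassoc_of% key₀, hφ, zero_comp, zero_add, Category.id_comp]
    · rw [reassoc_of% key ⟨j, h⟩, biproduct.ι_desc, sub_add_cancel]

/-- In degree `n` the hull is the sum of the `X l` with `n ≤ l ≤ n + N - 1`, and `X` maps to it by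
powers of `d`. The component `l = n` is the identity, so the map is split. -/
lemma nonempty_hull (X : NComplex A N) : Nonempty (Hull (levelwiseSplit A N) X) := by
  rcases N.eq_zero_or_pos with hN | hN
  · exact ⟨{ I := X, Q := X, ι := 0, π := 0, zero := zero_comp
             exact := levelwiseSplit_of_eq_zero hN _
             projInj := IsProjInj.of_isZero (isZero_of_eq_zero hN X) }⟩
  · have (n : ℤ) : Finite {l : ℤ // l - N + 1 ≤ n ∧ n ≤ l} :=
      Set.Finite.subset (Set.finite_Icc n (n + N)) fun l hl => ⟨hl.2, by have := hl.1; lia⟩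
    have hbu (l : ℤ) : l + 1 = l - N + 1 + N := by lia
    have h0 (n : ℤ) : n - N + 1 ≤ n ∧ n ≤ n := ⟨by lia, le_rfl⟩
    let ι : X ⟶ strip (b := fun l => l - N + 1) (u := fun l => l) hbu X.obj.obj :=
      toStrip fun l => 𝟙 (X.obj.obj l)
    obtain ⟨Q, π, w, hE⟩ := exists_cokernel ι _ _ _ _ fun n =>
      isSplitBy_biproduct_lift (fun l : {l : ℤ // l - N + 1 ≤ n ∧ n ≤ l} => X.obj.obj l)
        ⟨n, h0 n⟩ (fun l => X.obj.map (homOfLE l.2.2) ≫ 𝟙 _)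
        (by rw [Category.comp_id, X.map_self])
    exact ⟨⟨_, Q, ι, π, w, hE, isProjInj_strip hN⟩⟩

lemma exists_cohull (X : NComplex A N) : ∃ (W P : NComplex A N) (i : W ⟶ P) (p : P ⟶ X)
    (w : i ≫ p = 0), levelwiseSplit A N (ShortComplex.mk i p w) ∧
      IsProjInj (levelwiseSplit A N) P := by
  rcases N.eq_zero_or_pos with hN | hN
  · exact ⟨X, X, 0, 0, zero_comp, levelwiseSplit_of_eq_zero hN _,
      IsProjInj.of_isZero (isZero_of_eq_zero hN X)⟩
  · have (n : ℤ) : Finite {l : ℤ // l ≤ n ∧ n ≤ l + N - 1} :=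
      Set.Finite.subset (Set.finite_Icc (n - N) n) fun l hl => ⟨by have := hl.2; lia, hl.1⟩
    have hbu (l : ℤ) : l + N - 1 + 1 = l + N := by lia
    have h0 (n : ℤ) : n ≤ n ∧ n ≤ n + N - 1 := ⟨le_rfl, by lia⟩
    let p : strip (b := fun l => l) (u := fun l => l + N - 1) hbu X.obj.obj ⟶ X :=
      fromStrip fun l => 𝟙 (X.obj.obj l)
    obtain ⟨W, i, w, hE⟩ := exists_kernel p _ _ _ _ fun n =>
      isSplitBy_biproduct_desc (fun l : {l : ℤ // l ≤ n ∧ n ≤ l + N - 1} => X.obj.obj l)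
        ⟨n, h0 n⟩ (fun l => 𝟙 _ ≫ X.obj.map (homOfLE l.2.1))
        (by rw [Category.id_comp, X.map_self])
    exact ⟨W, _, i, p, w, hE, isProjInj_strip hN⟩

variable (A N) in
lemma isFrobenius : IsFrobenius (levelwiseSplit A N) where
  epi := epi_g
  mono := mono_f
  exists_desc := exists_desc
  exists_lift := exists_lift
  of_isZero := levelwiseSplit_of_isZero
  exists_biprod_lift := exists_biprod_lift
  biprod_lift_desc := levelwiseSplit_biprod_lift_desc
  exists_comp := exists_comp
  nonempty_hull := nonempty_hull
  exists_cohull := exists_cohull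

end NComplex

/-! ### The shift and the triangulated structure on the homotopy category -/

namespace RelativeExact

attribute [local instance] CategoryStruct.toQuiver hasBinaryBiproducts_of_finite_biproducts

variable {C : Type u} [Category.{v} C] [Preadditive C] [HasFiniteBiproducts C]
  {S : ObjectProperty (ShortComplex C)}

/-- Biproducts are inherited from `C` through the additive quotient functor; `shiftFunctor_additive`
needs them. -/
instance : HasFiniteBiproducts (StableCategory S) := by
  have := preservesBinaryBiproducts_of_preservesBiproducts (toStable S)
  have : HasBinaryBiproducts (StableCategory S) := ⟨fun X Y =>
    inferInstanceAs (HasBinaryBiproduct ((toStable S).obj X.as) ((toStable S).obj Y.as))⟩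
  have : HasFiniteProducts (StableCategory S) := hasFiniteProducts_of_has_binary_and_terminal
  exact HasFiniteBiproducts.of_hasFiniteProducts

variable (hS : IsFrobenius S)

/-- The identification of the last term of a hull with the shift of the first one, for the shift
defined by the suspension. -/
def hullShiftIso :
    letI := hasShiftOfIsEquivalence (suspension hS)
    ∀ (X : C) (H : Hull S X), (toStable S).obj H.Q ≅ ((toStable S).obj X)⟦(1 : ℤ)⟧ :=
  let := hasShiftOfIsEquivalence (suspension hS)
  fun X H => suspensionIso hS X H ≪≫
    ((shiftFunctorOneIso (suspension hS)).app ((toStable S).obj X)).symm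

lemma isNaturalSuspension_hullShiftIso :
    letI := hasShiftOfIsEquivalence (suspension hS)
    IsNaturalSuspension (hullShiftIso hS) := by
  let := hasShiftOfIsEquivalence (suspension hS)
  intro X X' H H' f a b ha hb
  refine ((Category.assoc _ _ _).symm.trans (congrArg (· ≫ _)
    (suspensionIso_naturality hS H H' f a b ha hb))).trans ?_
  refine (Category.assoc _ _ _).trans (Eq.trans ?_ (Category.assoc _ _ _).symm)
  exact congrArg (_ ≫ ·)
    ((shiftFunctorOneIso (suspension hS)).inv.naturality ((toStable S).map f))

end RelativeExact

end

theorem corollary4p9 (A : Type u) [Category.{v} A] [Preadditive A] [HasFiniteBiproducts A]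
    (N : ℕ) :
    ∃ (_ : HasShift (KN A N) ℤ) (_ : ∀ n : ℤ, (shiftFunctor (KN A N) n).Additive)
      (_ : Pretriangulated (KN A N))
      (e : ∀ (X : NComplex A N) (H : RelativeExact.Hull (levelwiseSplit A N) X),
        (toKN A N).obj H.Q ≅ ((toKN A N).obj X)⟦(1 : ℤ)⟧),
      IsTriangulated (KN A N) ∧
      RelativeExact.IsNaturalSuspension e ∧
      (∀ E : ShortComplex (NComplex A N), levelwiseSplit A N E →
        ∃! h, RelativeExact.IsInducedBy e E h) ∧
      (∀ (E : ShortComplex (NComplex A N))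
        (h : (toKN A N).obj E.X₃ ⟶ ((toKN A N).obj E.X₁)⟦(1 : ℤ)⟧), levelwiseSplit A N E →
        RelativeExact.IsInducedBy e E h →
        Triangle.mk ((toKN A N).map E.f) ((toKN A N).map E.g) h ∈ distTriang (KN A N)) ∧
      (∀ T : Triangle (KN A N), T ∈ distTriang (KN A N) →
        ∃ (E : ShortComplex (NComplex A N))
          (h : (toKN A N).obj E.X₃ ⟶ ((toKN A N).obj E.X₁)⟦(1 : ℤ)⟧), levelwiseSplit A N E ∧
          RelativeExact.IsInducedBy e E h ∧
          Nonempty (T ≅ Triangle.mk ((toKN A N).map E.f) ((toKN A N).map E.g) h)) := by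
  have hS := NComplex.isFrobenius A N
  let := hasShiftOfIsEquivalence (RelativeExact.suspension hS)
  have hadd (n : ℤ) : (shiftFunctor (KN A N) n).Additive := shiftFunctor_additive n
  have he := RelativeExact.isNaturalSuspension_hullShiftIso hS
  refine ⟨inferInstance, hadd, RelativeExact.pretriangulated hS he,
    RelativeExact.hullShiftIso hS, RelativeExact.isTriangulated hS he, he,
    fun E hE => ?_, fun E h hE hh => RelativeExact.stableTriangle_mem hE hh, fun T hT => hT⟩
  obtain ⟨h, hh⟩ := RelativeExact.exists_isInducedBy (e := RelativeExact.hullShiftIso hS) hS hE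
  exact ⟨h, hh, fun h' hh' => RelativeExact.IsInducedBy.unique hS he hE hh' hh⟩
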